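/- Consider a network of $N$ linearly (diffusively) coupled Rössler systems $$\dot{\boldsymbol x}_i=\boldsymbol f_i(\boldsymbol x_i)+\rho\sum_{j=1}^N A_{ij}\,[\boldsymbol g(\boldsymbol x_j)-\boldsymbol g(\boldsymbol x_i)],\qquad i=1,\dots,N,$$ where $\boldsymbol x_i=(x_i,y_i,z_i)\in\mathbb R^3$, $\boldsymbol f_i(\boldsymbol x_i)=(-y_i-z_i,\;x_i+a_iy_i,\;b+z_i(x_i-c))$, the $a_i,b,c,\rho$ are real parameters, $A=(A_{ij})$ is an arbitrary (possibly directed) adjacency matrix with entries in $\{0,1\}$, and $\boldsymbol g$ is one of the three coupling functions $(x,0,0)$, $(0,y,0)$, $(0,0,z)$. Let $\boldsymbol F$ be the resulting vector field on $\mathbb R^{3N}$, and let $\mathcal L_{\boldsymbol F}^k h$ be the $k$th Lie derivative of $h$ along $\boldsymbol F$. Let $s$ be a node and $S$ a set of three nodes. Measuring variables of node $s$ only, form for non-negative integers $\alpha,\beta,\gamma$ with $\alpha+\beta+\gamma=9$ the reconstructed vector $\boldsymbol X$ whose nine components are the successive Lie derivatives $\mathcal L_{\boldsymbol F}^kx_s$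 $(0\le k<\alpha)$, $\mathcal L_{\boldsymbol F}^ky_s$ $(0\le k<\beta)$ and $\mathcal L_{\boldsymbol F}^kz_s$ $(0\le k<\gamma)$, and let $\mathcal O_X$, the observability matrix, be its $9\times 3N$ Jacobian matrix. One says that $\boldsymbol X$ reconstructs with global observability the ($9$-dimensional) space associated with the nodes of $S$ if at every point of $\mathbb R^{3N}$ the differentials of all nine state variables of the nodes of $S$ lie in the span of the differentials of the components of $\boldsymbol X$, that is, in the row space of $\mathcal O_X$; for $N=3$ this means that $\operatorname{rank}\mathcal O_X=9$ at every point of $\mathbb R^9$. Then, for every choice of the network, of $s$ and of $S$, no such vector $\boldsymbol X$ reconstructs with global observability the space associated with the nodes of $S$: the state space of three nodes cannot be reconstructed with global observability from measurements at a single node. -/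

import Mathlib

/-- The state `(x, y, z)` of one node; the coordinates `0, 1, 2 : Fin 3` are `x, y, z`. -/
abbrev NodeState : Type := Fin 3 → ℝ

/-- The state of a network of `N` nodes, a point of `ℝ^(3N)`. -/
abbrev NetState (N : ℕ) : Type := Fin N → NodeState

/-- The Rössler vector field `(-y - z, x + a y, b + z (x - c))`. -/
def rossler (a b c : ℝ) (u : NodeState) : NodeState :=
  ![-u 1 - u 2, u 0 + a * u 1, b + u 2 * (u 0 - c)]

/-- The linear coupling function through the variable `q`: it is `(x, 0, 0)`, `(0, y, 0)` or
`(0, 0, z)` for `q = 0, 1, 2`. -/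
def coupling (q : Fin 3) (u : NodeState) : NodeState := Pi.single q (u q)

/-- The vector field of a network of diffusively coupled Rössler systems,
`f_i (a_i, x_i) + ρ ∑_j A_ij (g (x_j) - g (x_i))` at node `i`, where `g` is the coupling function
through the variable `q`. -/
def rosslerNetwork {N : ℕ} (a : Fin N → ℝ) (b c ρ : ℝ) (A : Matrix (Fin N) (Fin N) ℝ)
    (q : Fin 3) (x : NetState N) : NetState N :=
  fun i => rossler (a i) b c (x i) + ρ • ∑ j, A i j • (coupling q (x j) - coupling q (x i))

/-- The `k`th order Lie derivative of the scalar function `h` along the vector field `f`. -/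
noncomputable def lieDeriv {E : Type*} [NormedAddCommGroup E] [NormedSpace ℝ E]
    (f : E → E) (h : E → ℝ) : ℕ → E → ℝ
  | 0 => h
  | k + 1 => fun x => fderiv ℝ (lieDeriv f h k) x (f x)

/-- The components of the vector reconstructed from measurements at the node `s` alone: for each
variable `v` of that node, the first `κ v` successive Lie derivatives, of orders
`0, …, κ v - 1`. Thus `κ v = 0` means that the variable `v` is not measured. -/
noncomputable def reconstructed {N : ℕ} (f : NetState N → NetState N) (s : Fin N)
    (κ : Fin 3 → ℕ) (r : (v : Fin 3) × Fin (κ v)) : NetState N → ℝ :=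
  lieDeriv f (fun x => x s r.1) r.2

/-- The observability matrix of the reconstructed vector at the point `x`, that is, its Jacobian
matrix with respect to the `3N` state variables of the network. -/
noncomputable def observabilityMatrix {N : ℕ} (f : NetState N → NetState N) (s : Fin N)
    (κ : Fin 3 → ℕ) (x : NetState N) : Matrix ((v : Fin 3) × Fin (κ v)) (Fin N × Fin 3) ℝ :=
  fun r p => fderiv ℝ (reconstructed f s κ r) x (Pi.single p.1 (Pi.single p.2 1))

/-- The vector reconstructed from the node `s` reconstructs, with global observability, the space
`ℝ^(3 |S|)` of the states of the nodes in `S`: it has as many components as that space has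
dimensions, and at every point of the state space of the network the differentials of all the
state variables of the nodes in `S` are combinations of the differentials of its components, i.e.
the corresponding unit vectors lie in the row space of the observability matrix. If `S` consists
of all nodes, this says that the (square) observability matrix has full rank everywhere. -/
def ReconstructsGlobally {N : ℕ} (f : NetState N → NetState N) (s : Fin N)
    (κ : Fin 3 → ℕ) (S : Finset (Fin N)) : Prop :=
  ∑ v, κ v = 3 * S.card ∧
    ∀ x : NetState N, ∀ j ∈ S, ∀ v : Fin 3,
      (Pi.single (j, v) 1 : Fin N × Fin 3 → ℝ) ∈
        Submodule.span ℝ (Set.range (observabilityMatrix f s κ x))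

open Finset
open scoped ContDiff

/-! Nine components for nine state variables leave no slack: if their differentials span those of
the variables of `S`, they form a basis of that space. So at no point may the differential of one
component be a combination of the others, and no component may react to a perturbation outside `S`.
All this is read off from jets: `X` holds the Lie derivatives of the state variables at a point, `D`
their differentials in one direction, and both obey recursions obtained by differentiating the
equations (`isJet_jet`).

Dependences at the origin among the first Lie derivatives at `s` exclude every `κ` that does not
concentrate on one variable (`isLongMeasurement`). A long measurement controls the coupled variable
of `s` up to order 3, so it would notice a node outside `S` acting on `s` through a walk of length
at most 3 (`pow_apply_eq_zero`); conversely every node of `S` must act on `s` (`subset_of_closed`).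
Hence no edge enters `S` from outside, and `S` is either a star (both other nodes act on `s`) or a
chain (one acts on `s`, the other only on that one).

It remains to find, for each coupling, measured variable and shape, one state of a three-node
network where the differential of some Lie derivative of order 3 to 7 is a combination of the lower
ones (`exists_dependent_component`). Take a combination with unknown coefficients `e0`, `e1`, …,
reduce it to the initial variations, and require each coefficient to vanish. In nearly all cases the
equations can be ordered so that each is affine, with nonzero slope, in a fresh unknown: an `e`, a
coordinate of the point or a low derivative of it. They are therefore solvable over the reals for
all parameters. -/

/-- The Taylor coefficients (times factorials) `X` of a solution of a network of Rössler systems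
coupled through the variable `q` with weights `W`, and those `D` of a solution of the linearized
equation along it. -/
structure IsJet {ι : Type*} [Fintype ι] (q : Fin 3) (a : ι → ℝ) (b c : ℝ) (W : ι → ι → ℝ)
    (X D : ι → Fin 3 → ℕ → ℝ) : Prop where
  x_succ : ∀ i k, X i 0 (k + 1) = -X i 1 k - X i 2 k +
    if q = 0 then ∑ j, W i j * (X j 0 k - X i 0 k) else 0
  y_succ : ∀ i k, X i 1 (k + 1) = X i 0 k + a i * X i 1 k +
    if q = 1 then ∑ j, W i j * (X j 1 k - X i 1 k) else 0
  z_succ : ∀ i k, X i 2 (k + 1) = (if k = 0 then b else 0) +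
    ∑ l ∈ range (k + 1), (k.choose l : ℝ) * (X i 2 l * X i 0 (k - l)) - c * X i 2 k +
    if q = 2 then ∑ j, W i j * (X j 2 k - X i 2 k) else 0
  dx_succ : ∀ i k, D i 0 (k + 1) = -D i 1 k - D i 2 k +
    if q = 0 then ∑ j, W i j * (D j 0 k - D i 0 k) else 0
  dy_succ : ∀ i k, D i 1 (k + 1) = D i 0 k + a i * D i 1 k +
    if q = 1 then ∑ j, W i j * (D j 1 k - D i 1 k) else 0
  dz_succ : ∀ i k, D i 2 (k + 1) =
    ∑ l ∈ range (k + 1), (k.choose l : ℝ) * (X i 2 l * D i 0 (k - l) + D i 2 l * X i 0 (k - l)) -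
      c * D i 2 k + if q = 2 then ∑ j, W i j * (D j 2 k - D i 2 k) else 0

/-! ### Calculus of iterated Lie derivatives. -/

section LieDeriv
variable {E : Type*} [NormedAddCommGroup E] [NormedSpace ℝ E] {f : E → E} {g h : E → ℝ}

theorem contDiff_lieDeriv (hf : ContDiff ℝ ∞ f) (hh : ContDiff ℝ ∞ h) (k : ℕ) :
    ContDiff ℝ ∞ (lieDeriv f h k) := by
  induction k with
  | zero => exact hh
  | succ k ih => exact (ih.fderiv_right (m := ∞) le_rfl).clm_apply hf

theorem differentiable_lieDeriv (hf : ContDiff ℝ ∞ f) (hh : ContDiff ℝ ∞ h) (k : ℕ) :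
    Differentiable ℝ (lieDeriv f h k) :=
  (contDiff_lieDeriv hf hh k).differentiable (by simp)

theorem lieDeriv_succ_apply (k : ℕ) (x : E) :
    lieDeriv f h (k + 1) x = fderiv ℝ (lieDeriv f h k) x (f x) := rfl

/-- The definition peels off the outermost derivative; peeling off the innermost one lets the
network equations be substituted. -/
theorem lieDeriv_succ' (k : ℕ) :
    lieDeriv f h (k + 1) = lieDeriv f (fun x => fderiv ℝ h x (f x)) k := by
  induction k with
  | zero => rfl
  | succ k ih => funext x; rw [lieDeriv_succ_apply, ih]; rfl

theorem lieDeriv_const (r : ℝ) (k : ℕ) : lieDeriv f (fun _ => r) (k + 1) = fun _ => 0 := by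
  induction k with
  | zero => funext x; simp [lieDeriv]
  | succ k ih => funext x; rw [lieDeriv_succ_apply, ih]; simp

theorem lieDeriv_add (hf : ContDiff ℝ ∞ f) (hg : ContDiff ℝ ∞ g) (hh : ContDiff ℝ ∞ h) (k : ℕ) :
    lieDeriv f (fun x => g x + h x) k = fun x => lieDeriv f g k x + lieDeriv f h k x := by
  induction k with
  | zero => rfl
  | succ k ih =>
    funext x
    rw [lieDeriv_succ_apply, ih, fderiv_fun_add (differentiable_lieDeriv hf hg k x) (differentiable_lieDeriv hf hh k x)]
    rfl

theorem lieDeriv_const_mul (hf : ContDiff ℝ ∞ f) (hg : ContDiff ℝ ∞ g) (r : ℝ) (k : ℕ) :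
    lieDeriv f (fun x => r * g x) k = fun x => r * lieDeriv f g k x := by
  induction k with
  | zero => rfl
  | succ k ih =>
    funext x
    rw [lieDeriv_succ_apply, ih, fderiv_const_mul (differentiable_lieDeriv hf hg k x)]
    rfl

theorem lieDeriv_neg (hf : ContDiff ℝ ∞ f) (hg : ContDiff ℝ ∞ g) (k : ℕ) :
    lieDeriv f (fun x => -g x) k = fun x => -lieDeriv f g k x := by
  simpa using lieDeriv_const_mul hf hg (-1) k

theorem lieDeriv_sub (hf : ContDiff ℝ ∞ f) (hg : ContDiff ℝ ∞ g) (hh : ContDiff ℝ ∞ h) (k : ℕ) :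
    lieDeriv f (fun x => g x - h x) k = fun x => lieDeriv f g k x - lieDeriv f h k x := by
  simp only [sub_eq_add_neg]
  rw [lieDeriv_add hf hg hh.neg, lieDeriv_neg hf hh]

theorem lieDeriv_sum {ι : Type*} (s : Finset ι) {g : ι → E → ℝ} (hf : ContDiff ℝ ∞ f)
    (hg : ∀ i, ContDiff ℝ ∞ (g i)) (k : ℕ) :
    lieDeriv f (fun x => ∑ i ∈ s, g i x) k = fun x => ∑ i ∈ s, lieDeriv f (g i) k x := by
  induction k with
  | zero => rfl
  | succ k ih =>
    funext x
    rw [lieDeriv_succ_apply, ih, fderiv_fun_sum fun i _ => differentiable_lieDeriv hf (hg i) k x]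
    simp [lieDeriv]

theorem lieDeriv_mul (hf : ContDiff ℝ ∞ f) (hg : ContDiff ℝ ∞ g) (hh : ContDiff ℝ ∞ h) (k : ℕ) :
    lieDeriv f (fun x => g x * h x) k = fun x =>
      ∑ l ∈ range (k + 1), (k.choose l : ℝ) * (lieDeriv f g l x * lieDeriv f h (k - l) x) := by
  suffices lieDeriv f (fun x => g x * h x) k = fun x =>
      ∑ p ∈ antidiagonal k, (k.choose p.1 : ℝ) * (lieDeriv f g p.1 x * lieDeriv f h p.2 x) by
    rw [this]
    funext x
    rw [Nat.sum_antidiagonal_eq_sum_range_succ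
      fun i j => (k.choose i : ℝ) * (lieDeriv f g i x * lieDeriv f h j x)]
  induction k with
  | zero => funext x; simp [lieDeriv]
  | succ k ih =>
    funext x
    have hd := differentiable_lieDeriv hf hg
    have hd' := differentiable_lieDeriv hf hh
    rw [sum_antidiagonal_choose_succ_mul fun i j => lieDeriv f g i x * lieDeriv f h j x, lieDeriv_succ_apply, ih,
      fderiv_fun_sum fun p _ => ((hd _ x).fun_mul (hd' _ x)).const_mul _, ← sum_add_distrib,
      _root_.sum_apply]
    refine sum_congr rfl fun p hp => ?_
    rw [fderiv_const_mul ((hd _ x).fun_mul (hd' _ x)), fderiv_fun_mul (hd _ x) (hd' _ x)]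
    rw [← Nat.choose_symm_of_eq_add (mem_antidiagonal.1 hp).symm]
    simp [lieDeriv]
    left; ring
end LieDeriv

/-! ### Recursions for the jets of the network and their differentials. -/

section Network
variable {N : ℕ} (a : Fin N → ℝ) (b c ρ : ℝ) (A : Matrix (Fin N) (Fin N) ℝ) (q : Fin 3)

theorem rosslerNetwork_apply_zero (x : NetState N) (i : Fin N) :
    rosslerNetwork a b c ρ A q x i 0 = -x i 1 - x i 2 +
      if q = 0 then ∑ j, ρ * A i j * (x j 0 - x i 0) else 0 := by
  fin_cases q <;> simp [rosslerNetwork, rossler, coupling, mul_sum, mul_assoc]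

theorem rosslerNetwork_apply_one (x : NetState N) (i : Fin N) :
    rosslerNetwork a b c ρ A q x i 1 = x i 0 + a i * x i 1 +
      if q = 1 then ∑ j, ρ * A i j * (x j 1 - x i 1) else 0 := by
  fin_cases q <;> simp [rosslerNetwork, rossler, coupling, mul_sum, mul_assoc]

theorem rosslerNetwork_apply_two (x : NetState N) (i : Fin N) :
    rosslerNetwork a b c ρ A q x i 2 = b + x i 2 * (x i 0 - c) +
      if q = 2 then ∑ j, ρ * A i j * (x j 2 - x i 2) else 0 := by
  fin_cases q <;> simp [rosslerNetwork, rossler, coupling, mul_sum, mul_assoc]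

theorem contDiff_rosslerNetwork : ContDiff ℝ ∞ (rosslerNetwork a b c ρ A q) := by
  refine contDiff_pi.2 fun i => contDiff_pi.2 fun v => ?_
  fin_cases v
  · simp only [Fin.zero_eta, rosslerNetwork_apply_zero]; split_ifs <;> fun_prop
  · simp only [Fin.mk_one, rosslerNetwork_apply_one]; split_ifs <;> fun_prop
  · simp only [Fin.reduceFinMk, rosslerNetwork_apply_two]; split_ifs <;> fun_prop

/-- The successive Lie derivatives of the state variables along the network. -/
noncomputable def jet (x : NetState N) (i : Fin N) (v : Fin 3) (k : ℕ) : ℝ :=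
  lieDeriv (rosslerNetwork a b c ρ A q) (fun x => x i v) k x

/-- The differentials of the successive Lie derivatives of the state variables. -/
noncomputable def jetVariation (x δ : NetState N) (i : Fin N) (v : Fin 3) (k : ℕ) : ℝ :=
  fderiv ℝ (lieDeriv (rosslerNetwork a b c ρ A q) (fun x => x i v) k) x δ

theorem contDiff_apply_apply' (i : Fin N) (v : Fin 3) : ContDiff ℝ ∞ fun x : NetState N => x i v := by
  fun_prop

theorem jet_zero (x : NetState N) (i v) : jet a b c ρ A q x i v 0 = x i v := rfl

theorem fderiv_apply_apply (x δ : NetState N) (i : Fin N) (v : Fin 3) :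
    fderiv ℝ (fun x : NetState N => x i v) x δ = δ i v := by
  exact congrArg (· δ) (((ContinuousLinearMap.proj (R := ℝ) (φ := fun _ : Fin 3 => ℝ) v).comp
    (ContinuousLinearMap.proj (R := ℝ) (φ := fun _ : Fin N => NodeState) i)).fderiv (x := x))

theorem jetVariation_zero (x δ : NetState N) (i v) : jetVariation a b c ρ A q x δ i v 0 = δ i v :=
  fderiv_apply_apply x δ i v

theorem jet_succ (x : NetState N) (i v k) : jet a b c ρ A q x i v (k + 1) =
    lieDeriv (rosslerNetwork a b c ρ A q) (fun x => rosslerNetwork a b c ρ A q x i v) k x := by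
  rw [jet, lieDeriv_succ']
  simp only [fderiv_apply_apply]

/-- Along a line, the recursion for differentials follows from that for jets by uniqueness of
derivatives. -/
theorem hasDerivAt_jet (x δ : NetState N) (i v k) :
    HasDerivAt (fun t : ℝ => jet a b c ρ A q (x + t • δ) i v k) (jetVariation a b c ρ A q x δ i v k) 0 :=
  (differentiable_lieDeriv (contDiff_rosslerNetwork a b c ρ A q) (contDiff_apply_apply' i v) k x).hasFDerivAt.hasLineDerivAt δ

theorem lieDeriv_coupling (p : Prop) [Decidable p] (i : Fin N) (v : Fin 3) (k : ℕ) (x : NetState N) :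
    lieDeriv (rosslerNetwork a b c ρ A q) (fun x => if p then ∑ j, ρ * A i j * (x j v - x i v) else 0) k x =
      if p then ∑ j, ρ * A i j * (jet a b c ρ A q x j v k - jet a b c ρ A q x i v k) else 0 := by
  have hf := contDiff_rosslerNetwork a b c ρ A q
  split_ifs
  · rw [lieDeriv_sum _ hf fun j => by fun_prop]
    refine sum_congr rfl fun j _ => ?_
    rw [lieDeriv_const_mul hf (by fun_prop)]
    rw [lieDeriv_sub hf (by fun_prop) (by fun_prop)]
    rfl
  · rcases k with - | k
    · rfl
    · rw [lieDeriv_const]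

theorem jet_x_succ (x : NetState N) (i k) : jet a b c ρ A q x i 0 (k + 1) =
    -jet a b c ρ A q x i 1 k - jet a b c ρ A q x i 2 k +
    if q = 0 then ∑ j, ρ * A i j * (jet a b c ρ A q x j 0 k - jet a b c ρ A q x i 0 k) else 0 := by
  have hf := contDiff_rosslerNetwork a b c ρ A q
  rw [jet_succ, ← lieDeriv_coupling]
  simp only [rosslerNetwork_apply_zero]
  rw [lieDeriv_add hf (by fun_prop) (by split_ifs <;> fun_prop)]
  rw [lieDeriv_sub hf (by fun_prop) (by fun_prop), lieDeriv_neg hf (by fun_prop)]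
  rfl

theorem jet_y_succ (x : NetState N) (i k) : jet a b c ρ A q x i 1 (k + 1) =
    jet a b c ρ A q x i 0 k + a i * jet a b c ρ A q x i 1 k +
    if q = 1 then ∑ j, ρ * A i j * (jet a b c ρ A q x j 1 k - jet a b c ρ A q x i 1 k) else 0 := by
  have hf := contDiff_rosslerNetwork a b c ρ A q
  rw [jet_succ, ← lieDeriv_coupling]
  simp only [rosslerNetwork_apply_one]
  rw [lieDeriv_add hf (by fun_prop) (by split_ifs <;> fun_prop),
    lieDeriv_add hf (by fun_prop) (by fun_prop), lieDeriv_const_mul hf (by fun_prop)]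
  rfl

theorem jet_z_succ (x : NetState N) (i k) : jet a b c ρ A q x i 2 (k + 1) = (if k = 0 then b else 0) +
    ∑ l ∈ range (k + 1), (k.choose l : ℝ) * (jet a b c ρ A q x i 2 l * jet a b c ρ A q x i 0 (k - l)) -
      c * jet a b c ρ A q x i 2 k +
    if q = 2 then ∑ j, ρ * A i j * (jet a b c ρ A q x j 2 k - jet a b c ρ A q x i 2 k) else 0 := by
  have hf := contDiff_rosslerNetwork a b c ρ A q
  have hb : lieDeriv (rosslerNetwork a b c ρ A q) (fun _ => b) k x = if k = 0 then b else 0 := by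
    rcases k with - | k
    · rfl
    · rw [lieDeriv_const]; simp
  have he : ∀ x : NetState N, b + x i 2 * (x i 0 - c) = b + (x i 2 * x i 0 + -c * x i 2) := fun x => by ring
  rw [jet_succ, ← lieDeriv_coupling]
  simp only [rosslerNetwork_apply_two, he]
  rw [lieDeriv_add hf (by fun_prop) (by split_ifs <;> fun_prop),
    lieDeriv_add hf (by fun_prop) (by fun_prop), lieDeriv_add hf (by fun_prop) (by fun_prop),
    lieDeriv_const_mul hf (by fun_prop), lieDeriv_mul hf (by fun_prop) (by fun_prop)]
  simp only [hb, jet]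
  ring

theorem isJet_jet (x δ : NetState N) : IsJet q a b c (fun i j => ρ * A i j) (jet a b c ρ A q x)
    (jetVariation a b c ρ A q x δ) := by
  have H := hasDerivAt_jet a b c ρ A q x δ
  have h0 : ∀ i v k, jet a b c ρ A q (x + (0 : ℝ) • δ) i v k = jet a b c ρ A q x i v k := by simp
  have hc : ∀ (p : Prop) [Decidable p] (i : Fin N) (v : Fin 3) (k : ℕ), HasDerivAt (fun t : ℝ =>
      if p then ∑ j, ρ * A i j * (jet a b c ρ A q (x + t • δ) j v k - jet a b c ρ A q (x + t • δ) i v k) else 0)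
      (if p then ∑ j, ρ * A i j * (jetVariation a b c ρ A q x δ j v k - jetVariation a b c ρ A q x δ i v k) else 0) 0 := by
    intro p _ i v k
    split_ifs
    · exact HasDerivAt.fun_sum fun j _ => ((H j v k).sub (H i v k)).const_mul _
    · exact hasDerivAt_const _ _
  refine ⟨jet_x_succ a b c ρ A q x, jet_y_succ a b c ρ A q x, jet_z_succ a b c ρ A q x, fun i k => ?_, fun i k => ?_, fun i k => ?_⟩
  · have h := H i 0 (k + 1)
    simp only [jet_x_succ] at h
    exact h.unique (((H i 1 k).neg.sub (H i 2 k)).add (hc _ i 0 k))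
  · have h := H i 1 (k + 1)
    simp only [jet_y_succ] at h
    exact h.unique (((H i 0 k).add ((H i 1 k).const_mul _)).add (hc _ i 1 k))
  · have h := H i 2 (k + 1)
    simp only [jet_z_succ] at h
    have h' := h.unique ((((hasDerivAt_const (0 : ℝ) (if k = 0 then b else 0)).add
      (HasDerivAt.fun_sum fun l (_ : l ∈ range (k + 1)) => (((H i 2 l).mul (H i 0 (k - l))).const_mul (k.choose l : ℝ)))).sub
      ((H i 2 k).const_mul c)).add (hc _ i 2 k))
    rw [h']
    simp only [h0, zero_add]
    congr 2
    exact sum_congr rfl fun l _ => by ring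
end Network

/-! ### Linear algebra of global observability. -/

section Observability
variable {N : ℕ} {a : Fin N → ℝ} {b c ρ : ℝ} {A : Matrix (Fin N) (Fin N) ℝ} {q : Fin 3}
  {s : Fin N} {κ : Fin 3 → ℕ} {S : Finset (Fin N)}

theorem jetVariation_eq_sum (x δ : NetState N) (r : (v : Fin 3) × Fin (κ v)) :
    jetVariation a b c ρ A q x δ s r.1 r.2 =
      ∑ p : Fin N × Fin 3, observabilityMatrix (rosslerNetwork a b c ρ A q) s κ x r p * δ p.1 p.2 := by
  have : δ = ∑ p : Fin N × Fin 3, δ p.1 p.2 • (Pi.single p.1 (Pi.single p.2 1) : NetState N) := by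
    rw [Fintype.sum_prod_type]
    funext i v
    simp [Finset.sum_apply, Pi.single_apply, Finset.sum_ite_eq, apply_ite, ite_apply]
  conv_lhs => rw [this]
  rw [jetVariation, map_sum]
  refine sum_congr rfl fun p _ => ?_
  rw [map_smul, smul_eq_mul, mul_comm]
  rfl

theorem ReconstructsGlobally.exists_leftInverse (h : ReconstructsGlobally (rosslerNetwork a b c ρ A q) s κ S)
    (x : NetState N) : ∃ C : Matrix (S × Fin 3) ((v : Fin 3) × Fin (κ v)) ℝ, ∀ p p',
      ∑ r, C p r * observabilityMatrix (rosslerNetwork a b c ρ A q) s κ x r p' =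
        if ((p.1 : Fin N), p.2) = p' then 1 else 0 := by
  have : ∀ p : S × Fin 3, ∃ w : ((v : Fin 3) × Fin (κ v)) → ℝ,
      ∑ r, w r • observabilityMatrix (rosslerNetwork a b c ρ A q) s κ x r = Pi.single ((p.1 : Fin N), p.2) 1 :=
    fun p => (Submodule.mem_span_range_iff_exists_fun ℝ).1 (h.2 x p.1 p.1.2 p.2)
  choose C hC using this
  refine ⟨C, fun p p' => ?_⟩
  have := congrFun (hC p) p'
  simpa [Finset.sum_apply, Pi.single_apply, eq_comm] using this

/-- Perturbations seen by no component do not move the nodes of `S`. -/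
theorem ReconstructsGlobally.eq_zero (h : ReconstructsGlobally (rosslerNetwork a b c ρ A q) s κ S)
    {x δ : NetState N} (hδ : ∀ v, ∀ k < κ v, jetVariation a b c ρ A q x δ s v k = 0)
    {j : Fin N} (hj : j ∈ S) (v : Fin 3) : δ j v = 0 := by
  obtain ⟨C, hC⟩ := h.exists_leftInverse x
  have : ∑ r, C (⟨j, hj⟩, v) r * jetVariation a b c ρ A q x δ s r.1 r.2 = δ j v := by
    simp only [jetVariation_eq_sum, mul_sum]
    rw [sum_comm]
    simp only [← mul_assoc, ← sum_mul, hC]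
    simp
  rw [← this]
  exact sum_eq_zero fun r _ => by rw [hδ r.1 r.2 r.2.2, mul_zero]

/-- There are as many components as state variables in `S`, so the left inverse of the square block
of columns of `S` is two-sided. -/
theorem ReconstructsGlobally.exists_rightInverse (h : ReconstructsGlobally (rosslerNetwork a b c ρ A q) s κ S)
    (x : NetState N) : ∃ C : Matrix (S × Fin 3) ((v : Fin 3) × Fin (κ v)) ℝ, (∀ p p',
      ∑ r, C p r * observabilityMatrix (rosslerNetwork a b c ρ A q) s κ x r p' =
        if ((p.1 : Fin N), p.2) = p' then 1 else 0) ∧ ∀ r r',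
      ∑ p : S × Fin 3, observabilityMatrix (rosslerNetwork a b c ρ A q) s κ x r (p.1, p.2) * C p r' =
        if r = r' then 1 else 0 := by
  obtain ⟨C, hC⟩ := h.exists_leftInverse x
  refine ⟨C, hC, ?_⟩
  have hcard : Fintype.card (S × Fin 3) = Fintype.card ((v : Fin 3) × Fin (κ v)) := by
    simp [h.1, mul_comm]
  have h1 : C * Matrix.of (fun r (p : S × Fin 3) =>
      observabilityMatrix (rosslerNetwork a b c ρ A q) s κ x r (p.1, p.2)) = 1 := by
    ext p p'
    rw [Matrix.mul_apply, Matrix.one_apply]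
    simp only [Matrix.of_apply, hC, Prod.ext_iff, Subtype.ext_iff]
  have h2 := (Matrix.mul_eq_one_comm_of_equiv (Fintype.equivOfCardEq hcard)).1 h1
  intro r r'
  have := congrFun (congrFun h2 r) r'
  rwa [Matrix.mul_apply, Matrix.one_apply] at this

/-- With `B` the block of columns of `S`, one has `B C = 1`, hence `M = B (C M)`. Since the columns
of `C M` outside `S` are zero, so are those of `M`. -/
theorem ReconstructsGlobally.jetVariation_eq_zero (h : ReconstructsGlobally (rosslerNetwork a b c ρ A q) s κ S)
    {x δ : NetState N} (hδ : ∀ j ∈ S, ∀ v, δ j v = 0) {v : Fin 3} {k : ℕ} (hk : k < κ v) :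
    jetVariation a b c ρ A q x δ s v k = 0 := by
  obtain ⟨C, hC, hC'⟩ := h.exists_rightInverse x
  set M := observabilityMatrix (rosslerNetwork a b c ρ A q) s κ x with hM
  have key : ∀ r p', M r p' = ∑ p : S × Fin 3, M r (p.1, p.2) * if ((p.1 : Fin N), p.2) = p' then 1 else 0 := by
    intro r p'
    simp only [← hC, mul_sum, ← mul_assoc]
    rw [sum_comm]
    simp only [← sum_mul, hC']
    simp
  have := jetVariation_eq_sum (a := a) (b := b) (c := c) (ρ := ρ) (A := A) (q := q) (s := s) x δ ⟨v, ⟨k, hk⟩⟩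
  refine this.trans (sum_eq_zero fun p' _ => ?_)
  by_cases hp : p'.1 ∈ S
  · rw [hδ _ hp, mul_zero]
  · rw [← hM, key, sum_eq_zero, zero_mul]
    intro p _
    rw [if_neg, mul_zero]
    rintro rfl
    exact hp p.1.2

/-- A column of the right inverse, extended by zero outside `S`, is a dual basis vector to the
components. -/
theorem ReconstructsGlobally.exists_jetVariation_eq_single
    (h : ReconstructsGlobally (rosslerNetwork a b c ρ A q) s κ S)
    (x : NetState N) {v₀ : Fin 3} {k₀ : ℕ} (hk₀ : k₀ < κ v₀) :
    ∃ δ : NetState N, jetVariation a b c ρ A q x δ s v₀ k₀ = 1 ∧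
      ∀ v k, k < κ v → (v ≠ v₀ ∨ k ≠ k₀) → jetVariation a b c ρ A q x δ s v k = 0 := by
  obtain ⟨C, -, hC⟩ := h.exists_rightInverse x
  have key : ∀ r : (v : Fin 3) × Fin (κ v),
      jetVariation a b c ρ A q x (fun j v => if hj : j ∈ S then C (⟨j, hj⟩, v) ⟨v₀, ⟨k₀, hk₀⟩⟩ else 0) s r.1 r.2 =
        if r = ⟨v₀, ⟨k₀, hk₀⟩⟩ then 1 else 0 := by
    intro r
    rw [← hC, jetVariation_eq_sum, Fintype.sum_prod_type, Fintype.sum_prod_type,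
      ← sum_subset (subset_univ S) fun j _ hj => by simp [hj], ← sum_coe_sort]
    simp
  refine ⟨_, (key ⟨v₀, ⟨k₀, hk₀⟩⟩).trans (if_pos rfl), fun v k hk hne => (key ⟨v, ⟨k, hk⟩⟩).trans (if_neg ?_)⟩
  rintro h
  obtain ⟨rfl, h⟩ := Sigma.mk.inj_iff.1 h
  simp at h
  simp [h] at hne
end Observability

/-! ### Propagation of perturbations through the graph. -/

section Jet
variable {ι : Type*} [Fintype ι] {q : Fin 3} {a : ι → ℝ} {b c ρ : ℝ} {W : ι → ι → ℝ} {X D : ι → Fin 3 → ℕ → ℝ}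

/-- One step of the linearized equation for a node whose jets vanish up to the order `k`. -/
theorem IsJet.variation_succ (J : IsJet q a b c W X D) {i : ι} {k : ℕ} (h : ∀ l ≤ k, ∀ v, D i v l = 0) (v : Fin 3) :
    D i v (k + 1) = if v = q then ∑ j, W i j * D j q k else 0 := by
  have hs : ∑ l ∈ range (k + 1), (k.choose l : ℝ) * (X i 2 l * D i 0 (k - l) + D i 2 l * X i 0 (k - l)) = 0 :=
    sum_eq_zero fun l hl => by
      rw [h l (by simpa [Nat.lt_succ_iff] using hl), h (k - l) (by omega)]; ring
  fin_cases v
  · simp only [Fin.zero_eta, J.dx_succ, h k le_rfl, sub_zero, neg_zero, zero_add, eq_comm (a := q)]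
    split_ifs with hq
    · rw [← hq]
    · rfl
  · simp only [Fin.mk_one, J.dy_succ, h k le_rfl, sub_zero, mul_zero, zero_add, eq_comm (a := q)]
    split_ifs with hq
    · rw [← hq]
    · rfl
  · simp only [Fin.reduceFinMk, J.dz_succ, h k le_rfl, hs, sub_zero, mul_zero, zero_add, eq_comm (a := q)]
    split_ifs with hq
    · rw [← hq]
    · rfl

/-- The nodes of a set without incoming edges do not feel perturbations of the other nodes. -/
theorem IsJet.variation_eq_zero_of_closed (J : IsJet q a b c W X D) {T : Set ι}
    (hT : ∀ i ∈ T, ∀ j ∉ T, W i j = 0) (h : ∀ i ∈ T, ∀ v, D i v 0 = 0) (k : ℕ) :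
    ∀ i ∈ T, ∀ v, D i v k = 0 := by
  induction k using Nat.strong_induction_on with
  | _ k ih =>
    rcases k with - | k
    · exact h
    · intro i hi v
      rw [J.variation_succ fun l hl => ih l (by omega) i hi]
      split_ifs
      · refine sum_eq_zero fun j _ => ?_
        by_cases hj : j ∈ T
        · rw [ih k (by omega) j hj, mul_zero]
        · rw [hT i hi j hj, zero_mul]
      · rfl

theorem pow_apply_nonneg [DecidableEq ι] {A : Matrix ι ι ℝ} (hA : ∀ i j, 0 ≤ A i j) (d : ℕ) (i j : ι) :
    0 ≤ (A ^ d) i j := by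
  induction d generalizing i j with
  | zero => rw [pow_zero, Matrix.one_apply]; split_ifs <;> norm_num
  | succ d ih => rw [pow_succ, Matrix.mul_apply]; exact sum_nonneg fun l _ => mul_nonneg (ih _ _) (hA _ _)

/-- Nonnegative entries cannot cancel, so a walk from `l` to `j` prefixed by the edge at `i` would
make the longer power nonzero. -/
theorem pow_apply_eq_zero_of_pow_succ [DecidableEq ι] {A : Matrix ι ι ℝ} (hA : ∀ i j, 0 ≤ A i j) {d : ℕ}
    {i l j : ι} (h : (A ^ (d + 1)) i j = 0) (hil : A i l ≠ 0) : (A ^ d) l j = 0 := by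
  rw [pow_succ', Matrix.mul_apply,
    sum_eq_zero_iff_of_nonneg fun m _ => mul_nonneg (hA _ _) (pow_apply_nonneg hA _ _ _)] at h
  simpa [hil] using h l (mem_univ l)

/-- A perturbation of the coupled variable of the node `j` first reaches `i` along the shortest walks from `i` to `j`. -/
theorem IsJet.variation_eq_pow {A : Matrix ι ι ℝ} [DecidableEq ι] (hA : ∀ i j, 0 ≤ A i j)
    (J : IsJet q a b c (fun i j => ρ * A i j) X D) {j : ι}
    (h0 : ∀ i v, D i v 0 = if v = q ∧ i = j then 1 else 0) (d : ℕ) :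
    ∀ i, (∀ k < d, (A ^ k) i j = 0) →
      (∀ k < d, ∀ v, D i v k = 0) ∧ ∀ v, D i v d = if v = q then ρ ^ d * (A ^ d) i j else 0 := by
  induction d with
  | zero =>
    refine fun i _ => ⟨by simp, fun v => ?_⟩
    rw [h0, pow_zero, pow_zero, Matrix.one_apply]
    split_ifs <;> simp_all
  | succ d ih =>
    intro i hi
    obtain ⟨hlt, hd⟩ := ih i fun k hk => hi k (by omega)
    have hle : ∀ k ≤ d, ∀ v, D i v k = 0 := by
      intro k hk v
      rcases hk.lt_or_eq with hk | rfl
      · exact hlt k hk v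
      · rw [hd, hi k (by omega)]; simp
    refine ⟨fun k hk => hle k (by omega), fun v => ?_⟩
    rw [J.variation_succ hle]
    split_ifs
    · rw [pow_succ' A, Matrix.mul_apply, mul_sum]
      refine sum_congr rfl fun l _ => ?_
      by_cases hl : A i l = 0
      · simp [hl]
      · rw [((ih l fun k hk => ?_).2 q), if_pos rfl]
        · ring
        · exact pow_apply_eq_zero_of_pow_succ hA (hi (k + 1) (by omega)) hl
    · rfl

/-- A set of nodes that receives no edge from outside evolves autonomously. -/
theorem IsJet.comp {q : Fin 3} {ι' : Type*} [Fintype ι'] (J : IsJet q a b c W X D) {σ : ι' → ι}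
    (hσ : Function.Injective σ) (hW : ∀ i, ∀ j ∉ Set.range σ, W (σ i) j = 0) :
    IsJet q (fun i => a (σ i)) b c (fun i j => W (σ i) (σ j)) (fun i => X (σ i)) (fun i => D (σ i)) := by
  have hs : ∀ i (Y : ι → ℝ), ∑ j, W (σ i) (σ j) * Y (σ j) = ∑ j, W (σ i) j * Y j := fun i Y =>
    Fintype.sum_of_injective σ hσ _ _ (fun j hj => by rw [hW i j hj, zero_mul]) fun _ => rfl
  refine ⟨fun i k => ?_, fun i k => ?_, fun i k => ?_, fun i k => ?_, fun i k => ?_, fun i k => ?_⟩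
  · rw [J.x_succ, ← hs i fun j => X j 0 k - X (σ i) 0 k]
  · rw [J.y_succ, ← hs i fun j => X j 1 k - X (σ i) 1 k]
  · rw [J.z_succ, ← hs i fun j => X j 2 k - X (σ i) 2 k]
  · rw [J.dx_succ, ← hs i fun j => D j 0 k - D (σ i) 0 k]
  · rw [J.dy_succ, ← hs i fun j => D j 1 k - D (σ i) 1 k]
  · rw [J.dz_succ, ← hs i fun j => D j 2 k - D (σ i) 2 k]
end Jet

/-- The elimination tool: each use solves one equation for one unknown, `k` being the slope. -/
theorem exists_zero_of_affine {f : ℝ → ℝ} (k : ℝ) (hk : k ≠ 0) (h : ∀ t, f t = f 0 + k * t) :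
    ∃ t, f t = 0 :=
  ⟨-f 0 / k, by rw [h]; field_simp; ring⟩

theorem exists_ne_ne (u v : ℝ) : ∃ t, t ≠ u ∧ t ≠ v :=
  ⟨max u v + 1, by linarith [le_max_left u v], by linarith [le_max_right u v]⟩

/-! ### Degenerate points of three-node networks: coupling through `x`. -/

section ThreeNodes
variable {a : Fin 3 → ℝ} {b c ρ : ℝ} {W : Fin 3 → Fin 3 → ℝ}

/-- Letters `m`, `n` refer to nodes 1, 2. At each node `p` is `x - c` and `f` the first derivative
of `x`; `hXm`, `hYm`, `hZm` annihilate the coefficients of the initial `x`, `y`, `z` variations of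
node 1, likewise for `n`. At node 0, `he0` and `hs` do this for `y` and `z`. -/
theorem xCoupled_star_x (h1 : W 0 1 = ρ) (h2 : W 0 2 = ρ) : ∃ P : Fin 3 → Fin 3 → ℝ, ∀ X D, IsJet 0 a b c W X D →
   (∀ i v, X i v 0 = P i v) → (∀ k < 4, D 0 0 k = 0) → D 0 0 4 = 0 := by
  obtain ⟨am, ham⟩ : ∃ t, a 1 = t := ⟨_, rfl⟩
  obtain ⟨an, han⟩ : ∃ t, a 2 = t := ⟨_, rfl⟩
  obtain ⟨wmn, hwmn⟩ : ∃ t, W 1 2 = t := ⟨_, rfl⟩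
  obtain ⟨wnm, hwnm⟩ : ∃ t, W 2 1 = t := ⟨_, rfl⟩
  obtain ⟨dm, hdm⟩ : ∃ d, W 1 0 = d - wmn := ⟨W 1 0 + wmn, by ring⟩
  obtain ⟨dn, hdn⟩ : ∃ d, W 2 0 = d - wnm := ⟨W 2 0 + wnm, by ring⟩
  -- This value gives `ys` slope 1 in `hs`.
  obtain ⟨e2, he2⟩ : ∃ e2, e2 = 2 * ρ - a 0 - 1 := ⟨_, rfl⟩
  -- Two values of `e1` are avoided to keep `zm` and `zn` nonzero: they are, up to the factor -2,
  -- the slopes of `pm` and `pn` below.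
  obtain ⟨e1, zm, zn, hYm, hYn, hzm, hzn⟩ : ∃ e1 zm zn : ℝ,
      1 - am^2 - dm^2 - e1 + zm + am*dm - am*e2 - am*wnm + dm*e2 + dm*wnm + dn*wnm - e2*wnm - wmn*wnm = 0 ∧
      1 - an^2 - dn^2 - e1 + zn + an*dn - an*e2 - an*wmn + dm*wmn + dn*e2 + dn*wmn - e2*wmn - wmn*wnm = 0 ∧ zm ≠ 0 ∧ zn ≠ 0 := by
    obtain ⟨e1, h, h'⟩ := exists_ne_ne
      (1 - am^2 - dm^2 + am*dm - am*e2 - am*wnm + dm*e2 + dm*wnm + dn*wnm - e2*wnm - wmn*wnm)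
      (1 - an^2 - dn^2 + an*dn - an*e2 - an*wmn + dm*wmn + dn*e2 + dn*wmn - e2*wmn - wmn*wnm)
    refine ⟨e1, _, _, ?_, ?_, sub_ne_zero.2 h, sub_ne_zero.2 h'⟩ <;> ring
  obtain ⟨e0, he0⟩ : ∃ e0, a 0 ^ 3 + e2 * a 0 ^ 2 + e1 * a 0 + e0 = 0 :=
    exists_zero_of_affine 1 one_ne_zero fun t => by ring
  obtain ⟨pm, hXm⟩ : ∃ pm, -am - b + 2*dm - dm^3 + e0 - e2 - 2*wnm - dm*e1 + 2*dm*zm + dm^2*e2 + dm^2*wnm + dn^2*wnm + e1*wnm - e2*zm - 2*pm*zm + wmn*wnm^2 - wnm*zm - wnm*zn + dm*dn*wnm - dm*e2*wnm - 2*dm*wmn*wnm - dn*e2*wnm - dn*wmn*wnm + e2*wmn*wnm = 0 :=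
    exists_zero_of_affine (-2 * zm) (by simpa using hzm) fun t => by ring
  obtain ⟨pn, hXn⟩ : ∃ pn, -an - b + 2*dn - dn^3 + e0 - e2 - 2*wmn + dm^2*wmn - dn*e1 + 2*dn*zn + dn^2*e2 + dn^2*wmn + e1*wmn - e2*zn - 2*pn*zn - wmn*zm - wmn*zn + wmn^2*wnm + dm*dn*wmn - dm*e2*wmn - dm*wmn*wnm - dn*e2*wmn - 2*dn*wmn*wnm + e2*wmn*wnm = 0 :=
    exists_zero_of_affine (-2 * zn) (by simpa using hzn) fun t => by ring
  obtain ⟨fm, hZm⟩ : ∃ fm, 1 - dm^2 - e1 - fm - pm^2 + zm + dm*e2 + dm*pm + dm*wnm + dn*wnm - e2*pm - e2*wnm - pm*wnm - wmn*wnm = 0 :=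
    exists_zero_of_affine (-1) (by simp) fun t => by ring
  obtain ⟨fn, hZn⟩ : ∃ fn, 1 - dn^2 - e1 - fn - pn^2 + zn + dm*wmn + dn*e2 + dn*pn + dn*wmn - e2*pn - e2*wmn - pn*wmn - wmn*wnm = 0 :=
    exists_zero_of_affine (-1) (by simp) fun t => by ring
  obtain ⟨ys, hs⟩ : ∃ ys, -(c + a 0 * ys) - b - 2 * ρ * (ρ * (pm + pn) - ys) + ρ * (fm + fn) +
      e2 * (ρ * (pm + pn) - ys) + e0 = 0 :=
    exists_zero_of_affine 1 one_ne_zero fun t => by rw [he2]; ring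
  refine ⟨![![c, ys, 0], ![pm + c, -fm - zm + wmn * (pn - pm) - (dm - wmn) * pm, zm],
    ![pn + c, -fn - zn + wnm * (pm - pn) - (dn - wnm) * pn, zn]], fun X D J hP h => ?_⟩
  have d0 := h 0 (by simp)
  have d1 := h 1 (by simp)
  have d2 := h 2 (by simp)
  have d3 := h 3 (by simp)
  have hx00 : X 0 0 0 = c := hP 0 0
  have hx01 : X 0 1 0 = ys := hP 0 1
  have hx02 : X 0 2 0 = 0 := hP 0 2
  have hx10 : X 1 0 0 = pm + c := hP 1 0
  have hx11 : X 1 1 0 = -fm - zm + wmn * (pn - pm) - (dm - wmn) * pm := hP 1 1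
  have hx12 : X 1 2 0 = zm := hP 1 2
  have hx20 : X 2 0 0 = pn + c := hP 2 0
  have hx21 : X 2 1 0 = -fn - zn + wnm * (pm - pn) - (dn - wnm) * pn := hP 2 1
  have hx22 : X 2 2 0 = zn := hP 2 2
  have J0 := J.x_succ
  have J1 := J.y_succ
  have J2 := J.z_succ
  have E0 := J.dx_succ
  have E1 := J.dy_succ
  have E2 := J.dz_succ
  simp only [Fin.sum_univ_three, reduceIte, zero_ne_one, Fin.reduceEq, add_zero] at J0 J1 J2 E0 E1 E2
  have hf1 : X 1 0 1 = fm := by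
    rw [J0, hx00, hx10, hx11, hx12, hx20, hwmn, hdm]; ring
  have hf2 : X 2 0 1 = fn := by
    rw [J0, hx00, hx10, hx20, hx21, hx22, hwnm, hdn]; ring
  have core : e0 * (D 1 0 0 + D 2 0 0) + e1 * (D 1 0 1 + D 2 0 1) + e2 * (D 1 0 2 + D 2 0 2) +
      (D 1 0 3 + D 2 0 3) = 0 := by
    simp only [E0 1, E1 1, E2 1, E0 2, E1 2, E2 2, d0, d1, d2, sum_range_succ, sum_range_zero, J2, hx10, hx12, hx20, hx22,
      hf1, hf2, ham, han, hwmn, hwnm, hdm, hdn, Nat.reduceSub, Nat.choose, Nat.cast_one, Nat.reduceAdd, reduceIte]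
    norm_num
    linear_combination D 1 0 0 * hXm + D 1 1 0 * hYm + D 1 2 0 * hZm + D 2 0 0 * hXn + D 2 1 0 * hYn + D 2 2 0 * hZn
  have hf0 : X 0 0 1 = ρ * (pm + pn) - ys := by
    rw [J0, hx00, hx01, hx02, hx10, hx20, h1, h2]; ring
  have hg0 : X 0 0 2 = -(c + a 0 * ys) - b - 2 * ρ * (ρ * (pm + pn) - ys) + ρ * (fm + fn) := by
    rw [J0, J1, J2, hx00, hx01, hf0, hf1, hf2, h1, h2]; simp [hx00, hx02]; ring
  have h5 : D 0 0 4 + e2 * D 0 0 3 + e1 * D 0 0 2 + e0 * D 0 0 1 = 0 := by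
    rw [E0 0 0, E0 0 1, E0 0 2, E0 0 3]
    simp only [d0, d1, d2, d3, E1 0, E2 0, sum_range_succ, sum_range_zero, hx00, hx02, hf0, hg0, J2, h1, h2]
    norm_num
    linear_combination ρ * core - D 0 1 0 * he0 - D 0 2 0 * hs
  simpa [d1, d2, d3] using h5

theorem xCoupled_chain_x (h1 : W 0 1 = ρ) (h2 : W 0 2 = 0) : ∃ P : Fin 3 → Fin 3 → ℝ, ∀ X D, IsJet 0 a b c W X D →
   (∀ i v, X i v 0 = P i v) → (∀ k < 4, D 0 0 k = 0) → D 0 0 4 = 0 := by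
  obtain ⟨am, ham⟩ : ∃ t, a 1 = t := ⟨_, rfl⟩
  obtain ⟨an, han⟩ : ∃ t, a 2 = t := ⟨_, rfl⟩
  obtain ⟨wmn, hwmn⟩ : ∃ t, W 1 2 = t := ⟨_, rfl⟩
  obtain ⟨wnm, hwnm⟩ : ∃ t, W 2 1 = t := ⟨_, rfl⟩
  obtain ⟨dm, hdm⟩ : ∃ d, W 1 0 = d - wmn := ⟨W 1 0 + wmn, by ring⟩
  obtain ⟨dn, hdn⟩ : ∃ d, W 2 0 = d - wnm := ⟨W 2 0 + wnm, by ring⟩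
  -- Node 2 is placed at `x - c = an`, where the coefficients of its `y` and `z` variations
  -- coincide; one `e2` annihilates both.
  obtain ⟨e2, hYn⟩ : ∃ e2, dm + dn - an - e2 = 0 := exists_zero_of_affine (-1) (by simp) fun t => by ring
  -- Arranges slope -1 for `f` in `hf`.
  obtain ⟨p, hp⟩ : ∃ p, -3 * p - a 0 + ρ - e2 = 1 := ⟨(-1 - a 0 + ρ - e2) / 3, by ring⟩
  obtain ⟨e1, zm, hYm, hzm⟩ : ∃ e1 zm : ℝ,
      1 - am^2 - dm^2 - e1 + zm + am*dm - am*e2 + dm*e2 - wmn*wnm = 0 ∧ zm ≠ 0 :=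
    ⟨1 - am^2 - dm^2 + am*dm - am*e2 + dm*e2 - wmn*wnm + 1, 1, by ring, one_ne_zero⟩
  obtain ⟨zn, hXn⟩ : ∃ zn, -2 + dm^2 + dn^2 + e1 - zm - zn + wmn*wnm + dm*dn - dm*e2 - dn*e2 = 0 :=
    exists_zero_of_affine (-1) (by simp) fun t => by ring
  obtain ⟨e0, he0⟩ : ∃ e0, a 0 ^ 3 + e2 * a 0 ^ 2 + e1 * a 0 + e0 = 0 :=
    exists_zero_of_affine 1 one_ne_zero fun t => by ring
  obtain ⟨pm, hXm⟩ : ∃ pm, -am - b + 2*dm - dm^3 + e0 - e2 - dm*e1 + 2*dm*zm + dm^2*e2 - e2*zm - 2*pm*zm - 2*dm*wmn*wnm - dn*wmn*wnm + e2*wmn*wnm = 0 :=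
    exists_zero_of_affine (-2 * zm) (by simpa using hzm) fun t => by ring
  obtain ⟨fm, hZm⟩ : ∃ fm, 1 - dm^2 - e1 - fm - pm^2 + zm + dm*e2 + dm*pm - e2*pm - wmn*wnm = 0 :=
    exists_zero_of_affine (-1) (by simp) fun t => by ring
  obtain ⟨f, hf⟩ : ∃ f, -(p + c) - a 0 * (ρ * (pm - p) - f) - b - ρ * f + ρ * fm + 3 * p * f + p ^ 3 +
      e2 * (f + p ^ 2) + e1 * p + e0 = 0 :=
    exists_zero_of_affine (-1) (by simp) fun t => by linear_combination (-t) * hp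
  refine ⟨![![p + c, ρ * (pm - p) - f, 0], ![pm + c, -fm - zm + wmn * (an - pm) + (dm - wmn) * (p - pm), zm],
    ![an + c, 0, zn]], fun X D J hP h => ?_⟩
  have d0 := h 0 (by simp)
  have d1 := h 1 (by simp)
  have d2 := h 2 (by simp)
  have d3 := h 3 (by simp)
  have hx00 : X 0 0 0 = p + c := hP 0 0
  have hx01 : X 0 1 0 = ρ * (pm - p) - f := hP 0 1
  have hx02 : X 0 2 0 = 0 := hP 0 2
  have hx10 : X 1 0 0 = pm + c := hP 1 0
  have hx11 : X 1 1 0 = -fm - zm + wmn * (an - pm) + (dm - wmn) * (p - pm) := hP 1 1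
  have hx12 : X 1 2 0 = zm := hP 1 2
  have hx20 : X 2 0 0 = an + c := hP 2 0
  have hx22 : X 2 2 0 = zn := hP 2 2
  have J0 := J.x_succ
  have J1 := J.y_succ
  have J2 := J.z_succ
  have E0 := J.dx_succ
  have E1 := J.dy_succ
  have E2 := J.dz_succ
  simp only [Fin.sum_univ_three, reduceIte, zero_ne_one, Fin.reduceEq, add_zero] at J0 J1 J2 E0 E1 E2
  have hf1 : X 1 0 1 = fm := by
    rw [J0, hx00, hx10, hx11, hx12, hx20, hwmn, hdm]; ring
  have core : e0 * D 1 0 0 + e1 * D 1 0 1 + e2 * D 1 0 2 + D 1 0 3 = 0 := by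
    simp only [E0 1, E1 1, E2 1, E0 2, E1 2, E2 2, d0, d1, d2, sum_range_succ, sum_range_zero, J2, hx10, hx12, hx20, hx22,
      hf1, ham, han, hwmn, hwnm, hdm, hdn, Nat.reduceSub, Nat.choose, Nat.cast_one, Nat.reduceAdd, reduceIte]
    norm_num
    linear_combination D 1 0 0 * hXm + D 1 1 0 * hYm + D 1 2 0 * hZm +
      wmn * (D 2 0 0 * hXn + (D 2 1 0 + D 2 2 0) * hYn)
  have hf0 : X 0 0 1 = f := by
    rw [J0, hx00, hx01, hx02, hx10, h1, h2]; ring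
  have hg0 : X 0 0 2 = -(p + c) - a 0 * (ρ * (pm - p) - f) - b - ρ * f + ρ * fm := by
    rw [J0, J1, J2, hx00, hx01, hf0, hf1, h1, h2]; simp [hx00, hx02]; ring
  have h5 : D 0 0 4 + e2 * D 0 0 3 + e1 * D 0 0 2 + e0 * D 0 0 1 = 0 := by
    rw [E0 0 0, E0 0 1, E0 0 2, E0 0 3]
    simp only [d0, d1, d2, d3, E1 0, E2 0, sum_range_succ, sum_range_zero, hx00, hx02, hf0, hg0, J2, h1, h2]
    norm_num
    linear_combination ρ * core - D 0 1 0 * he0 - D 0 2 0 * hf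
  simpa [d1, d2, d3] using h5

/-! ### Coupling through `y`. -/

/-- The neighbours' part of the elimination, with `e2` left free. The right-hand side is feedback
from `y` of node 0, which vanishes when that variable is measured. -/
theorem yCoupled_star_core (e2 : ℝ) : ∃ e0 e1 zm zn pm pn g0 g1 : ℝ, ∀ X D : Fin 3 → Fin 3 → ℕ → ℝ,
    IsJet 1 a b c W X D →
    X 1 0 0 = pm + c → X 1 2 0 = zm → X 2 0 0 = pn + c → X 2 2 0 = zn →
    e0 * (D 1 1 0 + D 2 1 0) + e1 * (D 1 1 1 + D 2 1 1) + e2 * (D 1 1 2 + D 2 1 2) +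
      (D 1 1 3 + D 2 1 3) =
      g0 * D 0 1 0 + g1 * D 0 1 1 + (W 1 0 + W 2 0) * D 0 1 2 := by
  obtain ⟨wmn, hwmn⟩ : ∃ t, W 1 2 = t := ⟨_, rfl⟩
  obtain ⟨wnm, hwnm⟩ : ∃ t, W 2 1 = t := ⟨_, rfl⟩
  obtain ⟨rm, hrm⟩ : ∃ t, W 1 0 = t := ⟨_, rfl⟩
  obtain ⟨rn, hrn⟩ : ∃ t, W 2 0 = t := ⟨_, rfl⟩
  obtain ⟨am, ham⟩ : ∃ t, a 1 = t + rm + wmn := ⟨a 1 - rm - wmn, by ring⟩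
  obtain ⟨an, han⟩ : ∃ t, a 2 = t + rn + wnm := ⟨a 2 - rn - wnm, by ring⟩
  -- With this `e1` the equations `hYm` and `hYn` are equivalent, so a single `e0` solves both.
  obtain ⟨e1, he1⟩ : ∃ e1, e1 = -(e2 * (am + an) + (am + an) ^ 2 - (am * an - wmn * wnm) - 2) :=
    ⟨_, rfl⟩
  obtain ⟨e0, hYm⟩ : ∃ e0, -2*am + am^3 + e0 - e2 - 2*wnm + am*e1 + am^2*e2 + am^2*wnm + an^2*wnm + e1*wnm + wmn*wnm^2 + am*an*wnm + am*e2*wnm + 2*am*wmn*wnm + an*e2*wnm + an*wmn*wnm + e2*wmn*wnm = 0 :=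
    exists_zero_of_affine 1 one_ne_zero fun t => by ring
  have hYn : -2*an + an^3 + e0 - e2 - 2*wmn + an*e1 + an^2*e2 + an^2*wmn + am^2*wmn + e1*wmn + wnm*wmn^2 + am*an*wmn + an*e2*wmn + 2*an*wmn*wnm + am*e2*wmn + am*wmn*wnm + e2*wmn*wnm = 0 := by
    linear_combination hYm - (am + wnm - an - wmn) * he1
  obtain ⟨zm, hXm⟩ : ∃ zm, -1 + am^2 + e1 - zm + am*e2 + am*wnm + an*wnm + e2*wnm + wmn*wnm = 0 :=
    exists_zero_of_affine (-1) (by simp) fun t => by ring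
  obtain ⟨zn, hXn⟩ : ∃ zn, -1 + an^2 + e1 - zn + an*e2 + an*wmn + am*wmn + e2*wmn + wmn*wnm = 0 :=
    exists_zero_of_affine (-1) (by simp) fun t => by ring
  obtain ⟨pm, hZm⟩ : ∃ pm, -am - e2 - pm - wnm = 0 :=
    exists_zero_of_affine (-1) (by simp) fun t => by ring
  obtain ⟨pn, hZn⟩ : ∃ pn, -an - e2 - pn - wmn = 0 :=
    exists_zero_of_affine (-1) (by simp) fun t => by ring
  refine ⟨e0, e1, zm, zn, pm, pn,
    e1 * (rm + rn) + e2 * ((am + wnm) * rm + (an + wmn) * rn) +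
      ((am ^ 2 + wnm * am + an * wnm + wmn * wnm - 1) * rm + (an ^ 2 + wmn * an + am * wmn + wmn * wnm - 1) * rn),
    e2 * (rm + rn) + (am + wnm) * rm + (an + wmn) * rn, fun X D J hx10 hx12 hx20 hx22 => ?_⟩
  have E0 := J.dx_succ
  have E1 := J.dy_succ
  have E2 := J.dz_succ
  simp only [Fin.sum_univ_three, reduceIte, one_ne_zero, Fin.reduceEq, add_zero] at E0 E1 E2
  simp only [E0 1, E1 1, E2 1, E0 2, E1 2, E2 2, sum_range_succ, sum_range_zero, hx10, hx12, hx20, hx22,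
      ham, han, hwmn, hwnm, hrm, hrn, Nat.reduceSub, Nat.choose, Nat.cast_one, Nat.reduceAdd]
  norm_num
  linear_combination D 1 1 0 * hYm + D 2 1 0 * hYn + D 1 0 0 * hXm + D 2 0 0 * hXn + D 1 2 0 * hZm + D 2 2 0 * hZn

theorem yCoupled_star_y (h1 : W 0 1 = ρ) (h2 : W 0 2 = ρ) : ∃ P : Fin 3 → Fin 3 → ℝ, ∀ X D, IsJet 1 a b c W X D →
   (∀ i v, X i v 0 = P i v) → (∀ k < 4, D 0 1 k = 0) → D 0 1 4 = 0 := by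
  obtain ⟨e0, e1, zm, zn, pm, pn, g0, g1, core⟩ := yCoupled_star_core (a := a) (b := b) (c := c) (W := W) 0
  obtain ⟨p, hX⟩ : ∃ p, e0 - 2 * p - b = 0 :=
    exists_zero_of_affine (-2) (by simp) fun t => by ring
  obtain ⟨f, hZ⟩ : ∃ f, e1 + f + p ^ 2 - 1 = 0 :=
    exists_zero_of_affine 1 one_ne_zero fun t => by ring
  refine ⟨![![p + c, -f - 1, 1], ![pm + c, 0, zm], ![pn + c, 0, zn]], fun X D J hP h => ?_⟩
  have d0 := h 0 (by simp)
  have d1 := h 1 (by simp)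
  have d2 := h 2 (by simp)
  have d3 := h 3 (by simp)
  have hx00 : X 0 0 0 = p + c := hP 0 0
  have hx01 : X 0 1 0 = -f - 1 := hP 0 1
  have hx02 : X 0 2 0 = 1 := hP 0 2
  have core := core X D J (hP 1 0) (hP 1 2) (hP 2 0) (hP 2 2)
  have J0 := J.x_succ
  have J1 := J.y_succ
  have J2 := J.z_succ
  have E0 := J.dx_succ
  have E1 := J.dy_succ
  have E2 := J.dz_succ
  simp only [Fin.sum_univ_three, reduceIte, one_ne_zero, Fin.reduceEq, add_zero] at J0 J1 J2 E0 E1 E2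
  have hf0 : X 0 0 1 = f := by
    rw [J0, hx01, hx02]; ring
  have h5 : D 0 1 4 + e1 * D 0 1 2 + e0 * D 0 1 1 = 0 := by
    rw [E1 0 0, E1 0 1, E1 0 3]
    simp only [d0, d1, d2, d3, E0 0, E2 0, sum_range_succ, sum_range_zero, hx00, hx02, hf0, J2, h1, h2] at core ⊢
    norm_num at core ⊢
    linear_combination ρ * core + D 0 0 0 * hX - D 0 2 0 * hZ
  simpa [d1, d2, d3] using h5

/-- While the `x` variation of node 0 vanishes, its `z` variation is minus its `y` variation, and
both are multiples of `D 0 1 0`. One scalar condition is left, `ht`. Taking `y = -t`, `z = t` keeps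
the first derivative of `x` at zero. -/
theorem yCoupled_star_x (h1 : W 0 1 = ρ) (h2 : W 0 2 = ρ) : ∃ P : Fin 3 → Fin 3 → ℝ, ∀ X D, IsJet 1 a b c W X D →
   (∀ i v, X i v 0 = P i v) → (∀ k < 5, D 0 0 k = 0) → D 0 0 5 = 0 := by
  obtain ⟨α, hα⟩ : ∃ t, a 0 = t + 2 * ρ := ⟨a 0 - 2 * ρ, by ring⟩
  -- The choices of `p` and `e2` give `t` slope 1 in `ht`.
  obtain ⟨p, hp⟩ : ∃ p, p = α - 1 := ⟨_, rfl⟩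
  obtain ⟨e2, he2⟩ : ∃ e2, e2 = 1 - ρ * (W 1 0 + W 2 0) - 5 * p := ⟨_, rfl⟩
  obtain ⟨e0, e1, zm, zn, pm, pn, g0, g1, core⟩ := yCoupled_star_core (a := a) (b := b) (c := c) (W := W) e2
  obtain ⟨t, ht⟩ : ∃ t, p ^ 4 + (4 * p - α + e2) * (-(p + c) + α * t - b - t * p) +
      (-(α * (p + c - α * t) + ρ * (pm + pn + 2 * c - (W 1 0 + W 2 0) * t)) - (b + t * p) * p) - α * p ^ 3 +
      e2 * (p ^ 3 - α * p ^ 2) + e1 * (p ^ 2 - α * p) + e0 * (p - α) -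
      ρ * (g0 + g1 * p + (W 1 0 + W 2 0) * p ^ 2) = 0 :=
    exists_zero_of_affine 1 one_ne_zero fun t => by rw [he2, hp]; ring
  refine ⟨![![p + c, -t, t], ![pm + c, 0, zm], ![pn + c, 0, zn]], fun X D J hP h => ?_⟩
  have d0 := h 0 (by simp)
  have d1 := h 1 (by simp)
  have d2 := h 2 (by simp)
  have d3 := h 3 (by simp)
  have d4 := h 4 (by simp)
  have hx00 : X 0 0 0 = p + c := hP 0 0
  have hx01 : X 0 1 0 = -t := hP 0 1
  have hx02 : X 0 2 0 = t := hP 0 2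
  have hx10 : X 1 0 0 = pm + c := hP 1 0
  have hx11 : X 1 1 0 = 0 := hP 1 1
  have hx20 : X 2 0 0 = pn + c := hP 2 0
  have hx21 : X 2 1 0 = 0 := hP 2 1
  have core := core X D J (hP 1 0) (hP 1 2) (hP 2 0) (hP 2 2)
  have J0 := J.x_succ
  have J1 := J.y_succ
  have J2 := J.z_succ
  have E0 := J.dx_succ
  have E1 := J.dy_succ
  have E2 := J.dz_succ
  simp only [Fin.sum_univ_three, reduceIte, one_ne_zero, Fin.reduceEq, add_zero] at J0 J1 J2 E0 E1 E2
  have hf0 : X 0 0 1 = 0 := by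
    rw [J0, hx01, hx02]; ring
  have hg0 : X 0 0 2 = -(p + c) + α * t - b - t * p := by
    rw [J0, J1, J2, h1, h2, hα]; simp [hx00, hx01, hx02, hx11, hx21]; ring
  have hh0 : X 0 0 3 = (-(α * (p + c - α * t) + ρ * (pm + pn + 2 * c - (W 1 0 + W 2 0) * t)) - (b + t * p) * p) := by
    rw [J0, J1, J2, hf0, h1, h2, hα]
    simp [J1, J2, sum_range_succ, hf0, hx00, hx01, hx02, hx11, hx21, hx10, hx20, h1, h2, hα]; ring
  have z0 : D 0 2 0 = - D 0 1 0 := by linarith [E0 0 0]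
  have z1 : D 0 2 1 = - D 0 1 1 := by linarith [E0 0 1]
  have z2 : D 0 2 2 = - D 0 1 2 := by linarith [E0 0 2]
  have z3 : D 0 2 3 = - D 0 1 3 := by linarith [E0 0 3]
  have y1 : D 0 1 1 = p * D 0 1 0 := by
    have := E2 0 0
    simp [d0, z0, z1, hx00] at this
    linear_combination -this
  have y2 : D 0 1 2 = p ^ 2 * D 0 1 0 := by
    have := E2 0 1
    simp [sum_range_succ, d0, d1, z0, z1, z2, y1, hx00, hf0] at this
    linear_combination -this
  have y3 : D 0 1 3 = (p ^ 3 + X 0 0 2) * D 0 1 0 := by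
    have := E2 0 2
    simp [sum_range_succ, d0, d1, d2, z0, z1, z2, z3, y1, y2, hx00, hf0] at this
    linear_combination -this
  have z4 : D 0 2 4 = -(p ^ 4 + 4 * p * X 0 0 2 + X 0 0 3) * D 0 1 0 := by
    rw [E2]
    simp [sum_range_succ, d0, d1, d2, d3, z0, z1, z2, z3, y1, y2, y3, hx00, hf0, Nat.choose]
    ring
  have u0 := E1 0 0
  have u1 := E1 0 1
  have u2 := E1 0 2
  rw [E0, z4, E1, d3, y3]
  rw [y1, y2] at core
  simp only [d0, d1, d2, y1, y2, y3, h1, h2, hα] at u0 u1 u2 ⊢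
  rw [hg0, hh0]
  rw [hg0] at u2
  linear_combination D 0 1 0 * ht - ρ * core - e0 * u0 - e1 * u1 - e2 * u2

/-- `T` and `Δ` are trace and determinant of the linear `y` dynamics of nodes 1 and 2. Eliminating
`e1` between `hYm` and `hYn` leaves the compatibility condition `h`. -/
theorem yCoupled_chain_core {am an T Δ : ℝ} (ham : a 1 = am + W 1 0 + W 1 2) (han : a 2 = an + W 2 0 + W 2 1)
    (hT : T = am + an) (hΔ : Δ = am * an - W 1 2 * W 2 1)
    {e0 e2 e3 zm : ℝ} (hzm : zm ≠ 0)
    (h : zm + e0 - (Δ + 1) * e2 - T * Δ * e3 + (Δ + 2) * (Δ + 1) - 1 - T ^ 2 * Δ = 0) :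
    ∃ e1 zn pm pn fm g0 g1 g2 : ℝ, ∀ X D : Fin 3 → Fin 3 → ℕ → ℝ,
    IsJet 1 a b c W X D →
    X 1 0 0 = pm + c → X 1 1 0 = -fm - zm → X 1 2 0 = zm → X 2 0 0 = pn + c → X 2 2 0 = zn →
    e0 * D 1 1 0 + e1 * D 1 1 1 + e2 * D 1 1 2 + e3 * D 1 1 3 + D 1 1 4 =
      g0 * D 0 1 0 + g1 * D 0 1 1 + g2 * D 0 1 2 + W 1 0 * D 0 1 3 := by
  obtain ⟨wmn, hwmn⟩ : ∃ t, W 1 2 = t := ⟨_, rfl⟩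
  obtain ⟨wnm, hwnm⟩ : ∃ t, W 2 1 = t := ⟨_, rfl⟩
  obtain ⟨rm, hrm⟩ : ∃ t, W 1 0 = t := ⟨_, rfl⟩
  obtain ⟨rn, hrn⟩ : ∃ t, W 2 0 = t := ⟨_, rfl⟩
  rw [hwmn, hwnm] at hΔ
  obtain ⟨w, hw⟩ : ∃ w, w = wmn * wnm := ⟨_, rfl⟩
  obtain ⟨e1, hYn⟩ : ∃ e1, -3*am + am^3 - 3*an + an^3 + e1 - 2*e3 + am*an^2 + am*e2 + 2*am*w + am^2*an + am^2*e3 + an*e2 + 2*an*w + an^2*e3 + e3*w + am*an*e3 = 0 :=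
    exists_zero_of_affine 1 one_ne_zero fun t => by ring
  have hYm : 1 - 3*am^2 + am^4 + e0 - e2 + zm + am*e1 - 2*am*e3 + am^2*e2 + am^3*e3 - 3*w + w^2 + 3*am^2*w + an^2*w + e2*w + 2*am*an*w + 2*am*e3*w + an*e3*w = 0 := by
    rw [hT, hΔ, ← hw] at h
    linear_combination h + am * hYn
  obtain ⟨pm, hXm⟩ : ∃ pm, -2*am + am^3 - b + e1 - e3 + am*e2 - am*zm + am^2*e3 - e3*zm - 2*pm*zm + 2*am*w + an*w + e3*w = 0 :=
    exists_zero_of_affine (-2 * zm) (by simpa using hzm) fun t => by ring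
  obtain ⟨fm, hZm⟩ : ∃ fm, 1 - am^2 - e2 - fm - pm^2 + zm - am*e3 - am*pm - e3*pm - w = 0 :=
    exists_zero_of_affine (-1) (by simp) fun t => by ring
  obtain ⟨zn, hXn⟩ : ∃ zn, -2 + am^2 + an^2 + e2 - zn + w + am*an + am*e3 + an*e3 = 0 :=
    exists_zero_of_affine (-1) (by simp) fun t => by ring
  obtain ⟨pn, hZn⟩ : ∃ pn, -am - an - e3 - pn = 0 :=
    exists_zero_of_affine (-1) (by simp) fun t => by ring
  obtain ⟨l, hl⟩ : ∃ l, l = am * rm + wmn * rn := ⟨_, rfl⟩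
  obtain ⟨k, hk⟩ : ∃ k, k = (am ^ 2 - 1 + w) * rm + wmn * (am + an) * rn := ⟨_, rfl⟩
  refine ⟨e1, zn, pm, pn, fm, e1 * rm + e2 * l + e3 * k + ((am ^ 3 + 2 * am * w + an * w - 2 * am) * rm +
    wmn * (am ^ 2 + am * an + an ^ 2 + w - 2) * rn), e2 * rm + e3 * l + k, e3 * rm + l,
    fun X D J hx10 hx11 hx12 hx20 hx22 => ?_⟩
  have J0 := J.x_succ
  have J2 := J.z_succ
  have E0 := J.dx_succ
  have E1 := J.dy_succ
  have E2 := J.dz_succ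
  simp only [Fin.sum_univ_three, reduceIte, one_ne_zero, Fin.reduceEq, add_zero] at J0 J2 E0 E1 E2
  have hf1 : X 1 0 1 = fm := by rw [J0, hx11, hx12]; ring
  simp only [E0 1, E1 1, E2 1, E0 2, E1 2, E2 2, J2, sum_range_succ, sum_range_zero, hx10, hx12, hx20, hx22,
      hf1, ham, han, hwmn, hwnm, hrm, hrn, Nat.reduceSub, Nat.choose, Nat.cast_one, Nat.reduceAdd, reduceIte, hl, hk]
  norm_num
  rw [hw] at *
  linear_combination D 1 1 0 * hYm + wmn * D 2 1 0 * hYn + D 1 0 0 * hXm + wmn * D 2 0 0 * hXn + D 1 2 0 * hZm + wmn * D 2 2 0 * hZn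

theorem yCoupled_chain_y (h1 : W 0 1 = ρ) (h2 : W 0 2 = 0) : ∃ P : Fin 3 → Fin 3 → ℝ, ∀ X D, IsJet 1 a b c W X D →
   (∀ i v, X i v 0 = P i v) → (∀ k < 5, D 0 1 k = 0) → D 0 1 5 = 0 := by
  obtain ⟨α, hα⟩ : ∃ t, a 0 = t + ρ := ⟨a 0 - ρ, by ring⟩
  obtain ⟨am, ham⟩ : ∃ t, a 1 = t + W 1 0 + W 1 2 := ⟨a 1 - W 1 0 - W 1 2, by ring⟩
  obtain ⟨an, han⟩ : ∃ t, a 2 = t + W 2 0 + W 2 1 := ⟨a 2 - W 2 0 - W 2 1, by ring⟩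
  obtain ⟨T, hT⟩ : ∃ t, t = am + an := ⟨_, rfl⟩
  obtain ⟨Δ, hΔ⟩ : ∃ t, t = am * an - W 1 2 * W 2 1 := ⟨_, rfl⟩
  -- The first expression is the slope of `f` in `hf`, the second becomes `zm`. If `Δ ≠ -1`, `e2`
  -- sets `zm = 1`; otherwise `e2` drops out, and `e3` or, when also `T = -b`, the position `p` must
  -- help.
  obtain ⟨e2, e3, p, hk, hz⟩ : ∃ e2 e3 p : ℝ, e3 + 3 * p + α ≠ 0 ∧
      (Δ + 1) * e2 + T * Δ * e3 - b * (e3 + 2 * p) - (Δ + 2) * (Δ + 1) + 1 + T ^ 2 * Δ ≠ 0 := by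
    by_cases hD : Δ + 1 = 0
    · obtain rfl : Δ = -1 := by linarith
      by_cases hb : b + T = 0
      · obtain rfl : T = -b := by linarith
        by_cases hb0 : b = 0
        · exact ⟨0, 1 - α, 0, by simp, by simp [hb0]⟩
        · refine ⟨0, 1 - α + 3 * b / 2, -b / 2, by ring_nf; simp, ?_⟩
          ring_nf; simp
      · obtain ⟨e3, h, h'⟩ := exists_ne_ne (-α) ((1 - T ^ 2) / (b + T))
        refine ⟨0, e3, 0, fun h0 => h (by linarith), fun h0 => h' ?_⟩
        rw [eq_div_iff hb]; linarith
    · obtain ⟨e2, he2⟩ : ∃ e2, (Δ + 1) * e2 + T * Δ * (1 - α) - b * (1 - α) - (Δ + 2) * (Δ + 1) + T ^ 2 * Δ = 0 :=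
        exists_zero_of_affine _ hD fun t => by ring
      exact ⟨e2, 1 - α, 0, by simp, fun h0 => one_ne_zero (α := ℝ) (by linear_combination h0 - he2)⟩
  -- This `e0` cancels the `x` variation of node 0.
  obtain ⟨e1, zn, pm, pn, fm, g0, g1, g2, core⟩ := yCoupled_chain_core (b := b) (c := c) ham han hT hΔ (e0 := b * (e3 + 2 * p)) (e2 := e2) (e3 := e3) hz (by ring)
  set zm := (Δ + 1) * e2 + T * Δ * e3 - b * (e3 + 2 * p) - (Δ + 2) * (Δ + 1) + 1 + T ^ 2 * Δ
  obtain ⟨f, hf⟩ : ∃ f, e1 + e2 * p + e3 * (f + p ^ 2) - (p + c - α * f + ρ * (-fm - zm)) - b + 3 * p * f + p ^ 3 - 2 * b = 0 :=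
    exists_zero_of_affine _ hk fun t => by ring
  refine ⟨![![p + c, -f, 0], ![pm + c, -fm - zm, zm], ![pn + c, 0, zn]], fun X D J hP h => ?_⟩
  have d0 := h 0 (by simp)
  have d1 := h 1 (by simp)
  have d2 := h 2 (by simp)
  have d3 := h 3 (by simp)
  have d4 := h 4 (by simp)
  have hx00 : X 0 0 0 = p + c := hP 0 0
  have hx01 : X 0 1 0 = -f := hP 0 1
  have hx02 : X 0 2 0 = 0 := hP 0 2
  have hx11 : X 1 1 0 = -fm - zm := hP 1 1
  have core := core X D J (hP 1 0) hx11 (hP 1 2) (hP 2 0) (hP 2 2)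
  have J0 := J.x_succ
  have J1 := J.y_succ
  have J2 := J.z_succ
  have E0 := J.dx_succ
  have E1 := J.dy_succ
  have E2 := J.dz_succ
  simp only [Fin.sum_univ_three, reduceIte, one_ne_zero, Fin.reduceEq, add_zero] at J0 J1 J2 E0 E1 E2
  have hf0 : X 0 0 1 = f := by
    rw [J0, hx01, hx02]; ring
  have hg0 : X 0 0 2 = - (p + c - α * f + ρ * (-fm - zm)) - b := by
    rw [J0, J1, J2, h1, h2, hα]; simp [hx00, hx01, hx02, hx11]; ring
  have h5 : D 0 1 5 + e3 * D 0 1 4 + e2 * D 0 1 3 + e1 * D 0 1 2 + b * (e3 + 2 * p) * D 0 1 1 = 0 := by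
    rw [E1 0 0, E1 0 1, E1 0 2, E1 0 3, E1 0 4]
    simp only [d0, d1, d2, d3, d4, E0 0, E2 0, sum_range_succ, sum_range_zero, hx00, hx02, hf0, hg0, J2, h1, h2] at core ⊢
    norm_num at core ⊢
    linear_combination ρ * core - D 0 2 0 * hf
  simpa [d1, d2, d3, d4] using h5

theorem yCoupled_chain_x (hρ : ρ ≠ 0) (h1 : W 0 1 = ρ) (h2 : W 0 2 = 0) (h12 : W 1 2 ≠ 0) :
   ∃ P : Fin 3 → Fin 3 → ℝ, ∀ X D, IsJet 1 a b c W X D →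
   (∀ i v, X i v 0 = P i v) → (∀ k < 6, D 0 0 k = 0) → D 0 0 6 = 0 := by
  obtain ⟨α, hα⟩ : ∃ t, a 0 = t + ρ := ⟨a 0 - ρ, by ring⟩
  obtain ⟨am, ham⟩ : ∃ t, a 1 = t + W 1 0 + W 1 2 := ⟨a 1 - W 1 0 - W 1 2, by ring⟩
  obtain ⟨an, han⟩ : ∃ t, a 2 = t + W 2 0 + W 2 1 := ⟨a 2 - W 2 0 - W 2 1, by ring⟩
  -- Makes the slope of `t` in `ht` equal to `-ρ * W 1 2`; `t` is the `y` coordinate of the far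
  -- node.
  obtain ⟨p, hp⟩ : ∃ p, p = (1 - am - an) / 5 := ⟨_, rfl⟩
  obtain ⟨T, hT⟩ : ∃ t, t = am + an := ⟨_, rfl⟩
  obtain ⟨Δ, hΔ⟩ : ∃ t, t = am * an - W 1 2 * W 2 1 := ⟨_, rfl⟩
  obtain ⟨e0, he0⟩ : ∃ e0, 1 + e0 - (Δ + 1) * 0 - T * Δ * 0 + (Δ + 2) * (Δ + 1) - 1 - T ^ 2 * Δ = 0 :=
    exists_zero_of_affine 1 one_ne_zero fun t => by ring
  obtain ⟨e1, zn, pm, pn, fm, g0, g1, g2, core⟩ := yCoupled_chain_core (b := b) (c := c) ham han hT hΔ one_ne_zero he0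
  obtain ⟨v, hv⟩ : ∃ v, v = p + c + ρ * (-fm - 1) := ⟨_, rfl⟩
  obtain ⟨m, hm⟩ : ∃ m, m = pm + c + am * (-fm - 1) := ⟨_, rfl⟩
  obtain ⟨n, hn⟩ : ∃ n, n = pn + c + W 2 1 * (-fm - 1) := ⟨_, rfl⟩
  obtain ⟨t, ht⟩ : ∃ t, (5 * p - α) * (-(α * v + ρ * (m + W 1 2 * t)) - b * p) +
      (-((-v - b) + α * (α * v + ρ * (m + W 1 2 * t)) +
        ρ * (fm + am * (m + W 1 2 * t) + W 1 0 * v + W 1 2 * (n + an * t))) - b * p ^ 2) +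
      (p ^ 5 + 10 * p ^ 2 * (-v - b) - α * (p ^ 4 + 4 * p * (-v - b)) + e1 * (p ^ 2 - α * p) +
        e0 * (p - α) - ρ * (g0 + g1 * p + g2 * p ^ 2 + W 1 0 * (p ^ 3 + (-v - b)))) = 0 :=
    exists_zero_of_affine (-ρ * W 1 2) (by simp [hρ, h12]) fun t => by rw [hp]; ring
  refine ⟨![![p + c, 0, 0], ![pm + c, -fm - 1, 1], ![pn + c, t, zn]], fun X D J hP h => ?_⟩
  have d0 := h 0 (by simp)
  have d1 := h 1 (by simp)
  have d2 := h 2 (by simp)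
  have d3 := h 3 (by simp)
  have d4 := h 4 (by simp)
  have d5 := h 5 (by simp)
  have hx00 : X 0 0 0 = p + c := hP 0 0
  have hx01 : X 0 1 0 = 0 := hP 0 1
  have hx02 : X 0 2 0 = 0 := hP 0 2
  have hx10 : X 1 0 0 = pm + c := hP 1 0
  have hx11 : X 1 1 0 = -fm - 1 := hP 1 1
  have hx12 : X 1 2 0 = 1 := hP 1 2
  have hx20 : X 2 0 0 = pn + c := hP 2 0
  have hx21 : X 2 1 0 = t := hP 2 1
  have core := core X D J hx10 hx11 hx12 hx20 (hP 2 2)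
  have J0 := J.x_succ
  have J1 := J.y_succ
  have J2 := J.z_succ
  have E0 := J.dx_succ
  have E1 := J.dy_succ
  have E2 := J.dz_succ
  simp only [Fin.sum_univ_three, reduceIte, one_ne_zero, Fin.reduceEq, add_zero] at J0 J1 J2 E0 E1 E2
  have hm0 : X 1 0 1 = fm := by
    rw [J0, hx11, hx12]; ring
  have hf0 : X 0 0 1 = 0 := by
    rw [J0, hx01, hx02]; ring
  have hy1 : X 0 1 1 = v := by
    rw [J1, hx00, hx01, hx11, h1, h2, hv]; ring
  have hz1 : X 0 2 1 = b := by
    rw [J2]; simp [hx02]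
  have hg0 : X 0 0 2 = -v - b := by
    rw [J0, hy1, hz1]
  have hm1 : X 1 1 1 = m + W 1 2 * t := by
    rw [J1, hx10, hx11, hx01, hx21, ham, hm]; ring
  have hn1 : X 2 1 1 = n + an * t := by
    rw [J1, hx20, hx11, hx01, hx21, han, hn]; ring
  have hy2 : X 0 1 2 = α * v + ρ * (m + W 1 2 * t) := by
    rw [J1, hf0, hy1, hm1, h1, h2, hα]; ring
  have hz2 : X 0 2 2 = b * p := by
    rw [J2]; simp [sum_range_succ, hf0, hx00, hx02, hz1]; ring
  have hh0 : X 0 0 3 = -(α * v + ρ * (m + W 1 2 * t)) - b * p := by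
    rw [J0, hy2, hz2]
  have hm2 : X 1 1 2 = fm + am * (m + W 1 2 * t) + W 1 0 * v + W 1 2 * (n + an * t) := by
    rw [J1, hm0, hm1, hy1, hn1, ham]; ring
  have hk0 : X 0 0 4 = -((-v - b) + α * (α * v + ρ * (m + W 1 2 * t)) +
        ρ * (fm + am * (m + W 1 2 * t) + W 1 0 * v + W 1 2 * (n + an * t))) - b * p ^ 2 := by
    rw [J0, J1, J2, hg0, hy2, hm2, h1, h2, hα]
    simp [sum_range_succ, hz1, hz2, hx02, hx00, hf0]
    ring
  have z0 : D 0 2 0 = - D 0 1 0 := by linarith [E0 0 0]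
  have z1 : D 0 2 1 = - D 0 1 1 := by linarith [E0 0 1]
  have z2 : D 0 2 2 = - D 0 1 2 := by linarith [E0 0 2]
  have z3 : D 0 2 3 = - D 0 1 3 := by linarith [E0 0 3]
  have z4 : D 0 2 4 = - D 0 1 4 := by linarith [E0 0 4]
  have y1 : D 0 1 1 = p * D 0 1 0 := by
    have := E2 0 0
    simp [d0, z0, z1, hx00] at this
    linear_combination -this
  have y2 : D 0 1 2 = p ^ 2 * D 0 1 0 := by
    have := E2 0 1
    simp [sum_range_succ, d0, d1, z0, z1, z2, y1, hx00, hf0] at this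
    linear_combination -this
  have y3 : D 0 1 3 = (p ^ 3 + X 0 0 2) * D 0 1 0 := by
    have := E2 0 2
    simp [sum_range_succ, d0, d1, d2, z0, z1, z2, z3, y1, y2, hx00, hf0] at this
    linear_combination -this
  have y4 : D 0 1 4 = (p ^ 4 + 4 * p * X 0 0 2 + X 0 0 3) * D 0 1 0 := by
    have := E2 0 3
    simp [sum_range_succ, d0, d1, d2, d3, z0, z1, z2, z3, z4, y1, y2, y3, hx00, hf0, Nat.choose] at this
    linear_combination -this
  have z5 : D 0 2 5 = -(p ^ 5 + 10 * p ^ 2 * X 0 0 2 + 5 * p * X 0 0 3 + X 0 0 4) * D 0 1 0 := by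
    rw [E2]
    simp [sum_range_succ, d0, d1, d2, d3, d4, z0, z1, z2, z3, z4, y1, y2, y3, y4, hx00, hf0, Nat.choose]
    ring
  have u0 := E1 0 0
  have u1 := E1 0 1
  rw [E0, z5, E1, d4, y4]
  rw [y1, y2, y3] at core
  simp only [d0, d1, y1, y2, h1, h2, hα] at u0 u1 ⊢
  rw [hg0] at core ⊢
  rw [hh0, hk0]
  linear_combination D 0 1 0 * ht - ρ * core - e0 * u0 - e1 * u1

/-! ### Coupling through `z`. -/

theorem zCoupled_star_coefficients (am an wmn wnm rm rn b c s : ℝ) {zm zn : ℝ}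
    (hz : zm = 1 ∧ zn = -1 ∨ b = 0 ∧ zm = 2 ∧ zn = 1) :
    ∃ e0 e1 e2 P Q fm fn zdm zdn zem zen gm gn : ℝ,
      zdm = b + P * zm + wmn * zn ∧ zdn = b + Q * zn + wnm * zm ∧
      zem = P * zdm + fm * zm + wmn * zdn + rm * s ∧ zen = Q * zdn + fn * zn + wnm * zdm + rn * s ∧
      gm = -(P + wmn + rm + c) + am * (fm + zm) - zdm ∧ gn = -(Q + wnm + rn + c) + an * (fn + zn) - zdn ∧
      zem - zm - zm^2 + e1*zm + e2*zdm + 2*fm*zm + P*zdm + P^2*zm + wnm*zdm + e2*P*zm + e2*wnm*zm + P*wnm*zm + Q*wnm*zm + wmn*wnm*zm = 0 ∧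
      -2*zdm - am*zm - e2*zm - P*zm - wnm*zm = 0 ∧
      e0 + gm + P^3 - 2*zdm + e1*P + e1*wnm + e2*fm + e2*P^2 - e2*zm + 3*fm*P + fm*wnm + 2*fn*wnm - 2*P*zm + P^2*wnm + Q^2*wnm + wmn*wnm^2 - wnm*zm - wnm*zn + e2*P*wnm + e2*Q*wnm + e2*wmn*wnm + P*Q*wnm + 2*P*wmn*wnm + Q*wmn*wnm = 0 ∧
      zen - zn - zn^2 + e1*zn + e2*zdn + 2*fn*zn + Q*zdn + Q^2*zn + wmn*zdn + e2*Q*zn + e2*wmn*zn + Q*wmn*zn + P*wmn*zn + wmn*wnm*zn = 0 ∧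
      -2*zdn - an*zn - e2*zn - Q*zn - wmn*zn = 0 ∧
      e0 + gn + Q^3 - 2*zdn + e1*Q + e1*wmn + e2*fn + e2*Q^2 - e2*zn + 3*fn*Q + fn*wmn + 2*fm*wmn - 2*Q*zn + Q^2*wmn + P^2*wmn + wnm*wmn^2 - wmn*zn - wmn*zm + e2*Q*wmn + e2*P*wmn + e2*wnm*wmn + Q*P*wmn + 2*Q*wnm*wmn + P*wnm*wmn = 0 := by
  have hzm : zm ≠ 0 := by rcases hz with ⟨h, -⟩ | ⟨-, h, -⟩ <;> norm_num [h]
  have hzn : zn ≠ 0 := by rcases hz with ⟨-, h⟩ | ⟨-, -, h⟩ <;> norm_num [h]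
  obtain ⟨P, hP⟩ : ∃ P : ℝ → ℝ, ∀ e, P e = -(2 * b + 2 * wmn * zn + (am + wnm + e) * zm) / (3 * zm) := ⟨_, fun e => rfl⟩
  obtain ⟨Q, hQ⟩ : ∃ Q : ℝ → ℝ, ∀ e, Q e = -(2 * b + 2 * wnm * zm + (an + wmn + e) * zn) / (3 * zn) := ⟨_, fun e => rfl⟩
  obtain ⟨zdm, hzdm⟩ : ∃ zd : ℝ → ℝ, ∀ e, zd e = b + P e * zm + wmn * zn := ⟨_, fun e => rfl⟩
  obtain ⟨zdn, hzdn⟩ : ∃ zd : ℝ → ℝ, ∀ e, zd e = b + Q e * zn + wnm * zm := ⟨_, fun e => rfl⟩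
  obtain ⟨fm, hfm⟩ : ∃ f : ℝ → ℝ → ℝ, ∀ e1 e2, f e1 e2 = -(P e2 * zdm e2 + wmn * zdn e2 + rm * s
      - zm - zm^2 + e1*zm + e2*zdm e2 + P e2*zdm e2 + (P e2)^2*zm + wnm*zdm e2 + e2*P e2*zm + e2*wnm*zm + P e2*wnm*zm + Q e2*wnm*zm + wmn*wnm*zm) / (3 * zm) :=
    ⟨_, fun _ _ => rfl⟩
  obtain ⟨fn, hfn⟩ : ∃ f : ℝ → ℝ → ℝ, ∀ e1 e2, f e1 e2 = -(Q e2 * zdn e2 + wnm * zdm e2 + rn * s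
      - zn - zn^2 + e1*zn + e2*zdn e2 + Q e2*zdn e2 + (Q e2)^2*zn + wmn*zdn e2 + e2*Q e2*zn + e2*wmn*zn + Q e2*wmn*zn + P e2*wmn*zn + wmn*wnm*zn) / (3 * zn) :=
    ⟨_, fun _ _ => rfl⟩
  obtain ⟨gm, hgm⟩ : ∃ g : ℝ → ℝ → ℝ, ∀ e1 e2, g e1 e2 = -(P e2 + wmn + rm + c) + am * (fm e1 e2 + zm) - zdm e2 := ⟨_, fun _ _ => rfl⟩
  obtain ⟨gn, hgn⟩ : ∃ g : ℝ → ℝ → ℝ, ∀ e1 e2, g e1 e2 = -(Q e2 + wnm + rn + c) + an * (fn e1 e2 + zn) - zdn e2 := ⟨_, fun _ _ => rfl⟩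
  obtain ⟨Zm, hZm⟩ : ∃ Z : ℝ → ℝ → ℝ, ∀ e1 e2, Z e1 e2 = gm e1 e2 + (P e2)^3 - 2*zdm e2 + e1*P e2 + e1*wnm + e2*fm e1 e2 + e2*(P e2)^2 - e2*zm + 3*fm e1 e2*P e2 + fm e1 e2*wnm + 2*fn e1 e2*wnm - 2*P e2*zm + (P e2)^2*wnm + (Q e2)^2*wnm + wmn*wnm^2 - wnm*zm - wnm*zn + e2*P e2*wnm + e2*Q e2*wnm + e2*wmn*wnm + P e2*Q e2*wnm + 2*P e2*wmn*wnm + Q e2*wmn*wnm :=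
    ⟨_, fun _ _ => rfl⟩
  obtain ⟨Zn, hZn⟩ : ∃ Z : ℝ → ℝ → ℝ, ∀ e1 e2, Z e1 e2 = gn e1 e2 + (Q e2)^3 - 2*zdn e2 + e1*Q e2 + e1*wmn + e2*fn e1 e2 + e2*(Q e2)^2 - e2*zn + 3*fn e1 e2*Q e2 + fn e1 e2*wmn + 2*fm e1 e2*wmn - 2*Q e2*zn + (Q e2)^2*wmn + (P e2)^2*wmn + wnm*wmn^2 - wmn*zn - wmn*zm + e2*Q e2*wmn + e2*P e2*wmn + e2*wnm*wmn + Q e2*P e2*wmn + 2*Q e2*wnm*wmn + P e2*wnm*wmn :=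
    ⟨_, fun _ _ => rfl⟩
  -- All but two equations are solved as functions of `e1`, `e2`. Those two need the same `e0`, so
  -- their difference must vanish: it is affine in `e2` if `am = an`, and otherwise affine in `e1`.
  obtain ⟨k, hk, hD⟩ : ∃ k : ℝ, k ≠ 0 ∧ ∀ e1 e2, Zm e1 e2 - Zn e1 e2 =
      Zm 0 0 - Zn 0 0 - (am - an) / 3 * e1 + k * e2 + (am - an) / 9 * e2 ^ 2 := by
    rcases hz with ⟨rfl, rfl⟩ | ⟨rfl, rfl, rfl⟩
    · refine ⟨4 / 3, by norm_num, fun e1 e2 => ?_⟩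
      simp only [hZm, hZn, hgm, hgn, hfm, hfn, hzdm, hzdn, hP, hQ]
      ring
    · refine ⟨2 / 3, by norm_num, fun e1 e2 => ?_⟩
      simp only [hZm, hZn, hgm, hgn, hfm, hfn, hzdm, hzdn, hP, hQ]
      ring
  obtain ⟨e1, e2, he⟩ : ∃ e1 e2, Zm e1 e2 - Zn e1 e2 = 0 := by
    by_cases h : am = an
    · obtain ⟨e2, he⟩ : ∃ e2, Zm 0 e2 - Zn 0 e2 = 0 :=
        exists_zero_of_affine k hk fun t => by rw [hD, h]; ring
      exact ⟨0, e2, he⟩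
    · obtain ⟨e1, he⟩ : ∃ e1, Zm e1 0 - Zn e1 0 = 0 :=
        exists_zero_of_affine (-(am - an) / 3) (div_ne_zero (neg_ne_zero.2 (sub_ne_zero.2 h)) three_ne_zero) fun t => by rw [hD]; ring
      exact ⟨e1, 0, he⟩
  refine ⟨-Zm e1 e2, e1, e2, P e2, Q e2, fm e1 e2, fn e1 e2, zdm e2, zdn e2, _, _, gm e1 e2, gn e1 e2,
    hzdm e2, hzdn e2, rfl, rfl, hgm e1 e2, hgn e1 e2, ?_, ?_, ?_, ?_, ?_, ?_⟩
  · rw [hfm]; field_simp; ring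
  · rw [hzdm, hP]; field_simp; ring
  · rw [hZm]; ring
  · rw [hfn]; field_simp; ring
  · rw [hzdn, hQ]; field_simp; ring
  · have h := hZn e1 e2
    linear_combination -he - h

theorem zCoupled_star_z (hρ : ρ ≠ 0) (h1 : W 0 1 = ρ) (h2 : W 0 2 = ρ) : ∃ P : Fin 3 → Fin 3 → ℝ, ∀ X D, IsJet 2 a b c W X D →
   (∀ i v, X i v 0 = P i v) → (∀ k < 4, D 0 2 k = 0) → D 0 2 4 = 0 := by
  obtain ⟨am, ham⟩ : ∃ t, a 1 = t := ⟨_, rfl⟩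
  obtain ⟨an, han⟩ : ∃ t, a 2 = t := ⟨_, rfl⟩
  obtain ⟨wmn, hwmn⟩ : ∃ t, W 1 2 = t := ⟨_, rfl⟩
  obtain ⟨wnm, hwnm⟩ : ∃ t, W 2 1 = t := ⟨_, rfl⟩
  obtain ⟨rm, hrm⟩ : ∃ t, W 1 0 = t := ⟨_, rfl⟩
  obtain ⟨rn, hrn⟩ : ∃ t, W 2 0 = t := ⟨_, rfl⟩
  -- The first derivative `s` of `z` at node 0 must be nonzero, to solve for `ψ` and `f`; it is `b`
  -- for the first pair and `3 * ρ` for the second.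
  obtain ⟨zm, zn, hz, hs⟩ : ∃ zm zn : ℝ, (zm = 1 ∧ zn = -1 ∨ b = 0 ∧ zm = 2 ∧ zn = 1) ∧
      b + ρ * (zm + zn) ≠ 0 := by
    by_cases hb : b = 0
    · exact ⟨2, 1, .inr ⟨hb, rfl, rfl⟩, by simp [hb, hρ]; norm_num⟩
    · exact ⟨1, -1, .inl ⟨rfl, rfl⟩, by simpa using hb⟩
  obtain ⟨s, hs0⟩ : ∃ s, s = b + ρ * (zm + zn) := ⟨_, rfl⟩
  rw [← hs0] at hs
  obtain ⟨e0, e1, e2, P, Q, fm, fn, zdm, zdn, zem, zen, gm, gn, hzdm, hzdn, hzem, hzen, hgm, hgn, hXm, hYm, hZm,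
    hXn, hYn, hZn⟩ := zCoupled_star_coefficients am an wmn wnm rm rn b c s hz
  obtain ⟨ψ, hψ⟩ : ∃ ψ, 3 * (ψ * s + ρ * (zdm + zdn)) + 3 * a 0 * s + 2 * e2 * s = 0 :=
    exists_zero_of_affine (3 * s) (by simpa using hs) fun t => by ring
  obtain ⟨f, hf⟩ : ∃ f, (ψ * (ψ * s + ρ * (zdm + zdn)) + 2 * f * s + ρ * (zem + zen)) - 3 * s +
      e2 * (ψ * s + ρ * (zdm + zdn)) + e1 * s = 0 :=
    exists_zero_of_affine (2 * s) (by simpa using hs) fun t => by ring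
  refine ⟨![![ψ + 2 * ρ + c, -f, 0], ![P + rm + wmn + c, -fm - zm, zm], ![Q + rn + wnm + c, -fn - zn, zn]], fun X D J hP h => ?_⟩
  have d0 := h 0 (by simp)
  have d1 := h 1 (by simp)
  have d2 := h 2 (by simp)
  have d3 := h 3 (by simp)
  have hx00 : X 0 0 0 = ψ + 2 * ρ + c := hP 0 0
  have hx01 : X 0 1 0 = -f := hP 0 1
  have hx02 : X 0 2 0 = 0 := hP 0 2
  have hx10 : X 1 0 0 = P + rm + wmn + c := hP 1 0
  have hx11 : X 1 1 0 = -fm - zm := hP 1 1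
  have hx12 : X 1 2 0 = zm := hP 1 2
  have hx20 : X 2 0 0 = Q + rn + wnm + c := hP 2 0
  have hx21 : X 2 1 0 = -fn - zn := hP 2 1
  have hx22 : X 2 2 0 = zn := hP 2 2
  have J0 := J.x_succ
  have J1 := J.y_succ
  have J2 := J.z_succ
  have E0 := J.dx_succ
  have E1 := J.dy_succ
  have E2 := J.dz_succ
  simp only [Fin.sum_univ_three, reduceIte, Fin.reduceEq, add_zero] at J0 J1 J2 E0 E1 E2
  have hf0 : X 0 0 1 = f := by rw [J0, hx01, hx02]; ring
  have hf1 : X 1 0 1 = fm := by rw [J0, hx11, hx12]; ring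
  have hf2 : X 2 0 1 = fn := by rw [J0, hx21, hx22]; ring
  have hs1 : X 0 2 1 = s := by
    rw [J2, h1, h2]; simp [hx02, hx12, hx22]; linear_combination -hs0
  have hzm1 : X 1 2 1 = zdm := by
    rw [J2]; simp [hx02, hx10, hx12, hx22, hrm, hwmn]; linear_combination -hzdm
  have hzn1 : X 2 2 1 = zdn := by
    rw [J2]; simp [hx02, hx20, hx12, hx22, hrn, hwnm]; linear_combination -hzdn
  have hs2 : X 0 2 2 = ψ * s + ρ * (zdm + zdn) := by
    rw [J2, h1, h2]; simp [sum_range_succ, hx00, hx02, hs1, hzm1, hzn1]; ring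
  have hzm2 : X 1 2 2 = zem := by
    rw [J2]; simp [sum_range_succ, hx10, hx12, hs1, hzm1, hzn1, hf1, hrm, hwmn]; linear_combination -hzem
  have hzn2 : X 2 2 2 = zen := by
    rw [J2]; simp [sum_range_succ, hx20, hx22, hs1, hzm1, hzn1, hf2, hrn, hwnm]; linear_combination -hzen
  have hg1 : X 1 0 2 = gm := by
    rw [J0, J1, hzm1, hx10, hx11, ham]; linear_combination -hgm
  have hg2 : X 2 0 2 = gn := by
    rw [J0, J1, hzn1, hx20, hx21, han]; linear_combination -hgn
  have hs3 : X 0 2 3 = ψ * (ψ * s + ρ * (zdm + zdn)) + 2 * f * s + ρ * (zem + zen) := by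
    rw [J2, h1, h2]; simp [sum_range_succ, hx00, hx02, hs1, hs2, hzm2, hzn2, hf0]; ring
  have core : e0 * (D 1 2 0 + D 2 2 0) + e1 * (D 1 2 1 + D 2 2 1) + e2 * (D 1 2 2 + D 2 2 2) +
      (D 1 2 3 + D 2 2 3) = 0 := by
    simp only [E0 1, E1 1, E2 1, E0 2, E1 2, E2 2, d0, d1, d2, sum_range_succ, sum_range_zero, hx10, hx12, hx20, hx22,
      hf1, hf2, hzm1, hzn1, hzm2, hzn2, hg1, hg2, ham, han, hwmn, hwnm, hrm, hrn, Nat.reduceSub, Nat.choose, Nat.cast_one, Nat.reduceAdd]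
    norm_num
    linear_combination D 1 0 0 * hXm + D 1 1 0 * hYm + D 1 2 0 * hZm + D 2 0 0 * hXn + D 2 1 0 * hYn + D 2 2 0 * hZn
  have h5 : D 0 2 4 + e2 * D 0 2 3 + e1 * D 0 2 2 + e0 * D 0 2 1 = 0 := by
    rw [E2 0 0, E2 0 1, E2 0 2, E2 0 3]
    simp only [d0, d1, d2, d3, E0 0, E1 0, sum_range_succ, sum_range_zero, hx00, hx02, hf0, hs1, hs2, hs3, h1, h2]
    norm_num
    linear_combination ρ * core + D 0 0 0 * hf - D 0 1 0 * hψ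
  simpa [d1, d2, d3] using h5

/-- With all `z` zero, the positions of nodes 1 and 2 make the sum of their `z` variations be driven
by node 0 alone. At node 0 the second derivative of the `z` variation is then `a 0 ^ 2` times it by
the choice of `f`, matching the `y` variation. -/
theorem zCoupled_star_x (h1 : W 0 1 = ρ) (h2 : W 0 2 = ρ) : ∃ P : Fin 3 → Fin 3 → ℝ, ∀ X D, IsJet 2 a b c W X D →
   (∀ i v, X i v 0 = P i v) → (∀ k < 3, D 0 0 k = 0) → D 0 0 3 = 0 := by
  obtain ⟨f, hf⟩ : ∃ f, f = a 0 ^ 2 - ρ * (W 1 0 + W 2 0) := ⟨_, rfl⟩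
  refine ⟨![![2 * ρ + c, -f, 0], ![W 1 0 + W 1 2 - W 2 1 + c, 0, 0], ![W 2 0 + W 2 1 - W 1 2 + c, 0, 0]], fun X D J hP h => ?_⟩
  have d0 := h 0 (by simp)
  have d1 := h 1 (by simp)
  have d2 := h 2 (by simp)
  have hx00 : X 0 0 0 = 2 * ρ + c := hP 0 0
  have hx01 : X 0 1 0 = -f := hP 0 1
  have hx02 : X 0 2 0 = 0 := hP 0 2
  have hx10 : X 1 0 0 = W 1 0 + W 1 2 - W 2 1 + c := hP 1 0
  have hx12 : X 1 2 0 = 0 := hP 1 2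
  have hx20 : X 2 0 0 = W 2 0 + W 2 1 - W 1 2 + c := hP 2 0
  have hx22 : X 2 2 0 = 0 := hP 2 2
  have J0 := J.x_succ
  have E0 := J.dx_succ
  have E1 := J.dy_succ
  have E2 := J.dz_succ
  simp only [Fin.sum_univ_three, reduceIte, Fin.reduceEq, add_zero] at J0 E0 E1 E2
  have hf0 : X 0 0 1 = f := by rw [J0, hx01, hx02]; ring
  have z0 : D 0 2 0 = -D 0 1 0 := by linarith [E0 0 0]
  have y1 : D 0 1 1 = a 0 * D 0 1 0 := by rw [E1, d0]; ring
  have y2 : D 0 1 2 = a 0 ^ 2 * D 0 1 0 := by rw [E1, d1, y1]; ring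
  have z1 : D 0 2 1 = -(a 0 * D 0 1 0) := by linarith [E0 0 1]
  have z2 : D 0 2 2 = -(a 0 ^ 2 * D 0 1 0) := by
    rw [E2]
    simp [sum_range_succ, E2 1, E2 2, d0, d1, z0, z1, hx00, hx02, hx10, hx12, hx20, hx22, hf0, h1, h2]
    linear_combination -D 0 1 0 * hf
  rw [E0, y2, z2]; ring

/-- The far node has `b = wmn * zn`, so the coefficients of its `x` and `y` variations share the
factor `b` with those of node 1 and can be divided by it. -/
theorem zCoupled_chain_core {am an wmn wnm rm rn zn σ e1 e2 e3 P Q E G fm fn : ℝ} (ham : a 1 = am) (han : a 2 = an)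
    (hwmn : W 1 2 = wmn) (hwnm : W 2 1 = wnm) (hrm : W 1 0 = rm) (hrn : W 2 0 = rn) (h2 : W 0 2 = 0)
    (hb : b = wmn * zn) (hE : E = 2*P + wmn + Q + rm) (hG : G = Q*(wmn + Q) + fn + 2*wmn*wnm + rn*wmn)
    (hYm : -3*E - 6*am - 4*e3 - 4*P = 0) (hYn : -2*(wmn + Q) - an - e3 - P - Q = 0)
    (hXm : -6 + (P*E + 4*fm + G + rm*σ) + 2*e2 + e3*E + 6*fm + P*E + 2*P^2 + 2*e3*P + 2*wmn*wnm = 0)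
    (hXn : G - 1 - zn + e2 + e3*(wmn + Q) + 3*fm + 2*fn + (P + Q)*(wmn + Q) + P^2 + Q^2 + wmn*wnm + e3*(P + Q) + P*Q = 0)
    (hZn : e1 + 3*(-(P + wmn + rm + c) + am*fm - 2*b) + (-(Q + wnm + rn + c) + an*(fn + zn) - zn*(wmn + Q)) + P^3 + Q^3 - 6*b - 2*zn*(wmn + Q) + e2*P + e2*Q + 2*e3*fm + e3*fn + e3*P^2 + e3*Q^2 - e3*zn + e3*wmn*wnm + 5*fm*P + 3*fm*Q + fn*P + 3*fn*Q + P*Q^2 - P*zn + 2*P*wmn*wnm + P^2*Q - 2*Q*zn + 2*Q*wmn*wnm + e3*P*Q = 0) :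
    ∃ e0 g0 g1 g2 : ℝ, ∀ X D : Fin 3 → Fin 3 → ℕ → ℝ, IsJet 2 a b c W X D →
    X 1 0 0 = P + rm + wmn + c → X 1 1 0 = -fm → X 1 2 0 = 0 → X 2 0 0 = Q + rn + wnm + c →
    X 2 1 0 = -fn - zn → X 2 2 0 = zn → X 0 2 0 = 0 → X 0 2 2 = b * σ →
    X 0 2 1 = b ∧ X 1 2 1 = 2 * b ∧ X 1 2 2 = b * E ∧ X 1 2 3 = b * (P*E + 4*fm + G + rm*σ) ∧
    e0 * D 1 2 0 + e1 * D 1 2 1 + e2 * D 1 2 2 + e3 * D 1 2 3 + D 1 2 4 =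
      g0 * D 0 2 0 + g1 * D 0 2 1 + g2 * D 0 2 2 + rm * D 0 2 3 := by
  obtain ⟨gm, hgm⟩ : ∃ g, g = -(P + wmn + rm + c) + am*fm - 2*b := ⟨_, rfl⟩
  obtain ⟨hm, hhm⟩ : ∃ h, h = -(fm + am * ((P + wmn + rm + c) - am*fm)) - b * E := ⟨_, rfl⟩
  rw [← hgm] at hZn
  obtain ⟨e0, hZm⟩ : ∃ e0, e0 + 3*fm^2 + hm + P^4 - 3*(b*E) + e1*P + e2*fm + e2*P^2 + e3*gm + e3*P^3 - 2*e3*(2*b) + 6*fm*P^2 + 4*gm*P - 5*P*(2*b) + wmn^2*wnm^2 + e2*wmn*wnm + 3*e3*fm*P + 4*fm*wmn*wnm + 2*fn*wmn*wnm + 3*P^2*wmn*wnm + Q^2*wmn*wnm - wmn*wnm*zn + 2*e3*P*wmn*wnm + e3*Q*wmn*wnm + 2*P*Q*wmn*wnm = 0 :=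
    exists_zero_of_affine 1 one_ne_zero fun t => by ring
  refine ⟨e0, e1*rm + 3*gm*rm + P^3*rm - 3*rm*(2*b) + e2*P*rm + e2*rn*wmn + 2*e3*fm*rm + e3*P^2*rm + 5*fm*P*rm + 3*fm*rn*wmn + 2*fn*rn*wmn + P^2*rn*wmn + Q^2*rn*wmn - rn*wmn*zn + rn*wmn^2*wnm + e3*P*rn*wmn + e3*Q*rn*wmn + e3*rm*wmn*wnm + P*Q*rn*wmn + 2*P*rm*wmn*wnm + Q*rm*wmn*wnm,
    e2*rm + 3*fm*rm + P^2*rm + e3*P*rm + e3*rn*wmn + P*rn*wmn + Q*rn*wmn + rm*wmn*wnm,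
    e3*rm + P*rm + rn*wmn, fun X D J hx10 hx11 hx12 hx20 hx21 hx22 hx02 hs2 => ?_⟩
  have J0 := J.x_succ
  have J1 := J.y_succ
  have J2 := J.z_succ
  have E0 := J.dx_succ
  have E1 := J.dy_succ
  have E2 := J.dz_succ
  simp only [Fin.sum_univ_three, reduceIte, Fin.reduceEq, add_zero] at J0 J1 J2 E0 E1 E2
  have hf1 : X 1 0 1 = fm := by rw [J0, hx11, hx12]; ring
  have hf2 : X 2 0 1 = fn := by rw [J0, hx21, hx22]; ring
  have hs1 : X 0 2 1 = b := by
    rw [J2]; simp [hx02, hx12, h2]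
  have hzm1 : X 1 2 1 = 2 * b := by
    rw [J2]; simp [hx02, hx10, hx12, hx22, hwmn]; linear_combination -hb
  have hzn1 : X 2 2 1 = zn * (wmn + Q) := by
    rw [J2]; simp [hx02, hx20, hx12, hx22, hrn, hwnm]; linear_combination hb
  have hzm2 : X 1 2 2 = b * E := by
    rw [J2]; simp [sum_range_succ, hx10, hx12, hs1, hzm1, hzn1, hf1, hrm, hwmn]
    linear_combination -b * hE - (wmn + Q) * hb
  have hzn2 : X 2 2 2 = zn * G := by
    rw [J2]; simp [sum_range_succ, hx20, hx22, hs1, hzm1, hzn1, hf2, hrn, hwnm]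
    linear_combination -zn * hG + (2 * wnm + rn) * hb
  have hy1 : X 1 1 1 = (P + wmn + rm + c) - am*fm := by rw [J1, hx10, hx11, ham]; ring
  have hg1 : X 1 0 2 = gm := by rw [J0, hy1, hzm1, hgm]; ring
  have hg2 : X 2 0 2 = -(Q + wnm + rn + c) + an*(fn + zn) - zn*(wmn + Q) := by
    rw [J0, J1, hzn1, hx20, hx21, han]; ring
  have hh1 : X 1 0 3 = hm := by rw [J0, J1, hf1, hy1, hzm2, ham, hhm]
  have hzm3 : X 1 2 3 = b * (P*E + 4*fm + G + rm*σ) := by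
    rw [J2]; simp [sum_range_succ, hx10, hx12, hs2, hzm1, hzm2, hzn2, hf1, hrm, hwmn]
    linear_combination -G * hb
  refine ⟨hs1, hzm1, hzm2, hzm3, ?_⟩
  simp only [E0 1, E1 1, E2 1, E0 2, E1 2, E2 2, sum_range_succ, sum_range_zero, hx10, hx12, hx20, hx22,
    hf1, hf2, hzm1, hzn1, hzm2, hzn2, hzm3, hg1, hg2, hh1, ham, han, hwmn, hwnm, hrm, hrn, Nat.reduceSub, Nat.choose, Nat.cast_one, Nat.reduceAdd]
  norm_num
  linear_combination D 1 0 0 * b * hXm + D 1 1 0 * b * hYm + D 1 2 0 * hZm + D 2 0 0 * wmn * zn * hXn +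
    D 2 1 0 * wmn * zn * hYn + D 2 2 0 * wmn * hZn

/-- The solution depends affinely on `e2 = t`, and the explicit slopes let a further equation be
solved for `t`. -/
theorem zCoupled_chain_coefficients {P Q E am an wmn wnm rm rn zn e3 : ℝ} (b c σ : ℝ)
    (hP : 9 * P = -(wmn - an + 3 * e3 + 3 * rm + 6 * am)) (hQ : 3 * Q = -(2 * wmn + an + e3 + P)) :
    ∃ fm fn e1 : ℝ → ℝ, (∀ t, fm t = fm 0 - 5 / 27 * t) ∧ (∀ t, fn t = fn 0 - 4 / 27 * t) ∧
      (∀ t, e1 t = e1 0 + (2 * P + 15 * am + 4 * an + 14 * e3) / 27 * t) ∧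
      ∀ t, -6 + (P*E + 4*fm t + (Q*(wmn + Q) + fn t + 2*wmn*wnm + rn*wmn) + rm*σ) + 2*t + e3*E + 6*fm t + P*E + 2*P^2 + 2*e3*P + 2*wmn*wnm = 0 ∧
      (Q*(wmn + Q) + fn t + 2*wmn*wnm + rn*wmn) - 1 - zn + t + e3*(wmn + Q) + 3*fm t + 2*fn t + (P + Q)*(wmn + Q) + P^2 + Q^2 + wmn*wnm + e3*(P + Q) + P*Q = 0 ∧
      e1 t + 3*(-(P + wmn + rm + c) + am*fm t - 2*b) + (-(Q + wnm + rn + c) + an*(fn t + zn) - zn*(wmn + Q)) + P^3 + Q^3 - 6*b - 2*zn*(wmn + Q) + t*P + t*Q + 2*e3*fm t + e3*fn t + e3*P^2 + e3*Q^2 - e3*zn + e3*wmn*wnm + 5*fm t*P + 3*fm t*Q + fn t*P + 3*fn t*Q + P*Q^2 - P*zn + 2*P*wmn*wnm + P^2*Q - 2*Q*zn + 2*Q*wmn*wnm + e3*P*Q = 0 := by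
  obtain rfl : P = -(wmn - an + 3 * e3 + 3 * rm + 6 * am) / 9 := by linarith
  set P := -(wmn - an + 3 * e3 + 3 * rm + 6 * am) / 9
  obtain ⟨A, hA⟩ : ∃ A, A = -6 + 2*P*E + (Q*(wmn + Q) + 2*wmn*wnm + rn*wmn) + rm*σ + e3*E + 2*P^2 + 2*e3*P + 2*wmn*wnm := ⟨_, rfl⟩
  obtain ⟨B, hB⟩ : ∃ B, B = (Q*(wmn + Q) + 2*wmn*wnm + rn*wmn) - 1 - zn + e3*(wmn + Q) + (P + Q)*(wmn + Q) + P^2 + Q^2 + wmn*wnm + e3*(P + Q) + P*Q := ⟨_, rfl⟩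
  refine ⟨fun t => -(5 * t + 3 * A - B) / 27, fun t => -(t + B) / 3 + (5 * t + 3 * A - B) / 27,
    fun t => -(3*(-(P + wmn + rm + c) + am*(-(5 * t + 3 * A - B) / 27) - 2*b) + (-(Q + wnm + rn + c) + an*((-(t + B) / 3 + (5 * t + 3 * A - B) / 27) + zn) - zn*(wmn + Q)) + P^3 + Q^3 - 6*b - 2*zn*(wmn + Q) + t*P + t*Q + 2*e3*(-(5 * t + 3 * A - B) / 27) + e3*(-(t + B) / 3 + (5 * t + 3 * A - B) / 27) + e3*P^2 + e3*Q^2 - e3*zn + e3*wmn*wnm + 5*(-(5 * t + 3 * A - B) / 27)*P + 3*(-(5 * t + 3 * A - B) / 27)*Q + (-(t + B) / 3 + (5 * t + 3 * A - B) / 27)*P + 3*(-(t + B) / 3 + (5 * t + 3 * A - B) / 27)*Q + P*Q^2 - P*zn + 2*P*wmn*wnm + P^2*Q - 2*Q*zn + 2*Q*wmn*wnm + e3*P*Q),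
    fun t => by ring, fun t => by ring, fun t => by ring, fun t => ⟨?_, ?_, ?_⟩⟩
  · linear_combination -hA
  · linear_combination -hB
  · ring

theorem zCoupled_chain_z_of_ne_zero (h1 : W 0 1 = ρ) (h2 : W 0 2 = 0) (h12 : W 1 2 ≠ 0) (hb : b ≠ 0) :
   ∃ P : Fin 3 → Fin 3 → ℝ, ∀ X D, IsJet 2 a b c W X D →
   (∀ i v, X i v 0 = P i v) → (∀ k < 5, D 0 2 k = 0) → D 0 2 5 = 0 := by
  obtain ⟨am, ham⟩ : ∃ t, a 1 = t := ⟨_, rfl⟩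
  obtain ⟨an, han⟩ : ∃ t, a 2 = t := ⟨_, rfl⟩
  obtain ⟨wmn, hwmn⟩ : ∃ t, W 1 2 = t := ⟨_, rfl⟩
  obtain ⟨wnm, hwnm⟩ : ∃ t, W 2 1 = t := ⟨_, rfl⟩
  obtain ⟨rm, hrm⟩ : ∃ t, W 1 0 = t := ⟨_, rfl⟩
  obtain ⟨rn, hrn⟩ : ∃ t, W 2 0 = t := ⟨_, rfl⟩
  rw [hwmn] at h12
  obtain ⟨zn, hzn⟩ : ∃ zn, b = wmn * zn := ⟨b / wmn, by field_simp⟩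
  obtain ⟨P, hP⟩ : ∃ P, 9 * P = -(wmn - an + 3 * 0 + 3 * rm + 6 * am) := ⟨-(wmn - an + 3 * 0 + 3 * rm + 6 * am) / 9, by ring⟩
  obtain ⟨Q, hQ⟩ : ∃ Q, 3 * Q = -(2 * wmn + an + 0 + P) := ⟨-(2 * wmn + an + 0 + P) / 3, by ring⟩
  obtain ⟨E, hE⟩ : ∃ E, E = 2*P + wmn + Q + rm := ⟨_, rfl⟩
  -- Gives the equation for `e2` slope 1.
  obtain ⟨ψ, hψ⟩ : ∃ ψ, -ψ / 4 + ρ / 2 - 3 * a 0 / 4 - 8 * ρ / 9 + (2 * P + 15 * am + 4 * an + 14 * 0) / 27 = 1 :=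
    ⟨4 * (-1 + ρ / 2 - 3 * a 0 / 4 - 8 * ρ / 9 + (2 * P + 15 * am + 4 * an + 14 * 0) / 27), by ring⟩
  obtain ⟨σ, hσ⟩ : ∃ σ, σ = ψ + 2 * ρ := ⟨_, rfl⟩
  obtain ⟨fm, fn, e1, hfm, hfn, he1, hcol⟩ := zCoupled_chain_coefficients (E := E) (wnm := wnm) (rn := rn) (zn := zn) b c σ hP hQ
  obtain ⟨f, hf⟩ : ∃ f : ℝ → ℝ, ∀ t, f t = (-6 * a 0 * σ + 4 * (1 - a 0 ^ 2) - 2 * t - 4 * (ψ * σ + ρ * E)) / 8 :=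
    ⟨_, fun t => rfl⟩
  obtain ⟨e2, he2⟩ : ∃ t, ψ * (ψ * σ + 2 * f t + ρ * E) + 3 * f t * σ +
      3 * (-(ψ + ρ + c) + a 0 * f t - b) + ρ * (P*E + 4*fm t + (Q*(wmn + Q) + fn t + 2*wmn*wnm + rn*wmn) + rm*σ) -
      6 * σ - 4 * a 0 + t * σ + e1 t = 0 := by
    refine exists_zero_of_affine 1 one_ne_zero fun t => ?_
    rw [he1 t, hfm t, hfn t, hf t, hf 0, hσ]
    linear_combination t * hψ
  obtain ⟨hXm, hXn, hZn⟩ := hcol e2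
  obtain ⟨e0, g0, g1, g2, core⟩ := zCoupled_chain_core (a := a) (c := c) (W := W) ham han hwmn hwnm hrm hrn h2 hzn hE rfl
    (by rw [hE]; linarith) (by linarith) hXm hXn hZn
  have hfe := hf e2
  generalize e1 e2 = e1, fm e2 = fm, fn e2 = fn, f e2 = f at *
  refine ⟨![![ψ + ρ + c, -f, 0], ![P + rm + wmn + c, -fm, 0], ![Q + rn + wnm + c, -fn - zn, zn]], fun X D J hP h => ?_⟩
  have d0 := h 0 (by simp)
  have d1 := h 1 (by simp)
  have d2 := h 2 (by simp)
  have d3 := h 3 (by simp)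
  have d4 := h 4 (by simp)
  have hx00 : X 0 0 0 = ψ + ρ + c := hP 0 0
  have hx01 : X 0 1 0 = -f := hP 0 1
  have hx02 : X 0 2 0 = 0 := hP 0 2
  have hx12 : X 1 2 0 = 0 := hP 1 2
  have core := core X D J (hP 1 0) (hP 1 1) hx12 (hP 2 0) (hP 2 1) (hP 2 2) hx02
  have J0 := J.x_succ
  have J1 := J.y_succ
  have J2 := J.z_succ
  have E0 := J.dx_succ
  have E1 := J.dy_succ
  have E2 := J.dz_succ
  simp only [Fin.sum_univ_three, reduceIte, Fin.reduceEq, add_zero] at J0 J1 J2 E0 E1 E2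
  have hf0 : X 0 0 1 = f := by rw [J0, hx01, hx02]; ring
  have hs1 : X 0 2 1 = b := by
    rw [J2]; simp [hx02, hx12, h2]
  have hzm1 : X 1 2 1 = 2 * b := by
    rw [J2, hwmn, hP 2 2, hx12, hx02]; simp [hx12]; linear_combination -hzn
  have hs2 : X 0 2 2 = b * σ := by
    rw [J2, h1, h2]; simp [sum_range_succ, hx00, hx02, hs1, hzm1]; rw [hσ]; ring
  obtain ⟨-, -, hm2, hm3, core⟩ := core hs2
  have hg0 : X 0 0 2 = -(ψ + ρ + c) + a 0 * f - b := by rw [J0, J1, hs1, hx00, hx01]; ring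
  have hs3 : X 0 2 3 = b * (ψ * σ + 2 * f + ρ * E) := by
    rw [J2, h1, h2]; simp [sum_range_succ, hx00, hx02, hs1, hs2, hf0, hm2]; ring
  have hs4 : X 0 2 4 = b * (ψ * (ψ * σ + 2 * f + ρ * E) + 3 * f * σ +
      3 * (-(ψ + ρ + c) + a 0 * f - b) + ρ * (P*E + 4*fm + (Q*(wmn + Q) + fn + 2*wmn*wnm + rn*wmn) + rm*σ)) := by
    rw [J2, h1, h2]; simp [sum_range_succ, hx00, hx02, hs1, hs2, hs3, hf0, hg0, hm3, Nat.choose]; ring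
  have h5 : D 0 2 5 + e2 * D 0 2 3 + e1 * D 0 2 2 + e0 * D 0 2 1 = 0 := by
    rw [E2 0 0, E2 0 1, E2 0 2, E2 0 4]
    simp only [d0, d1, d2, d3] at core
    simp only [d0, d1, d2, d3, d4, E0 0, E1 0, sum_range_succ, sum_range_zero, hx00, hx02, hf0, hs1, hs2, hs3, hs4,
      h1, h2, Nat.choose]
    norm_num
    linear_combination ρ * core + D 0 0 0 * b * he2 - 8 * D 0 1 0 * b * hfe
  simpa [d1, d2, d3] using h5

/-- If `b = 0`, then `z` stays zero from the origin and the `z` variations form a closed linear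
system. Its vanishing at node 0 to order 2 passes along the chain to nodes 1 and 2. -/
theorem zCoupled_chain_z_of_eq_zero (hρ : ρ ≠ 0) (h1 : W 0 1 = ρ) (h2 : W 0 2 = 0) (h12 : W 1 2 ≠ 0) (hb : b = 0) :
   ∃ P : Fin 3 → Fin 3 → ℝ, ∀ X D, IsJet 2 a b c W X D →
   (∀ i v, X i v 0 = P i v) → (∀ k < 5, D 0 2 k = 0) → D 0 2 5 = 0 := by
  refine ⟨0, fun X D J hP h => ?_⟩
  have J2 := J.z_succ
  have E2 := J.dz_succ
  simp only [Fin.sum_univ_three, reduceIte] at J2 E2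
  have hz : ∀ k i, X i 2 k = 0 := by
    intro k
    induction k using Nat.strong_induction_on with
    | _ k ih =>
      intro i
      rcases k with - | k
      · exact hP i 2
      · rw [J2, sum_eq_zero fun l hl => by rw [ih l (by simpa using hl)]; simp]
        simp [hb, ih k]
  have d0 := h 0 (by simp)
  have d1 := h 1 (by simp)
  have d2 := h 2 (by simp)
  have m0 : D 1 2 0 = 0 := by
    have := E2 0 0
    simpa [hz, d0, d1, h1, h2, hρ] using this
  have m1 : D 1 2 1 = 0 := by
    have := E2 0 1
    simpa [sum_range_succ, hz, d0, d1, d2, h1, h2, hρ] using this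
  have n0 : D 2 2 0 = 0 := by
    have := E2 1 0
    simpa [hz, d0, m0, m1, h12] using this
  have hd : ∀ k i, D i 2 k = 0 := by
    intro k
    induction k using Nat.strong_induction_on with
    | _ k ih =>
      intro i
      rcases k with - | k
      · fin_cases i <;> assumption
      · rw [E2, sum_eq_zero fun l hl => by rw [ih l (by simpa using hl), hz]; simp]
        simp [ih k]
  exact hd 5 0

theorem zCoupled_chain_x (h1 : W 0 1 = ρ) (h2 : W 0 2 = 0) (h12 : W 1 2 ≠ 0) :
   ∃ P : Fin 3 → Fin 3 → ℝ, ∀ X D, IsJet 2 a b c W X D →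
   (∀ i v, X i v 0 = P i v) → (∀ k < 6, D 0 0 k = 0) → D 0 0 6 = 0 := by
  obtain ⟨am, ham⟩ : ∃ t, a 1 = t := ⟨_, rfl⟩
  obtain ⟨an, han⟩ : ∃ t, a 2 = t := ⟨_, rfl⟩
  obtain ⟨wmn, hwmn⟩ : ∃ t, W 1 2 = t := ⟨_, rfl⟩
  obtain ⟨wnm, hwnm⟩ : ∃ t, W 2 1 = t := ⟨_, rfl⟩
  obtain ⟨rm, hrm⟩ : ∃ t, W 1 0 = t := ⟨_, rfl⟩
  obtain ⟨rn, hrn⟩ : ∃ t, W 2 0 = t := ⟨_, rfl⟩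
  obtain ⟨α, hα⟩ : ∃ t, a 0 = t := ⟨_, rfl⟩
  rw [hwmn] at h12
  obtain ⟨zn, hzn⟩ : ∃ zn, b = wmn * zn := ⟨b / wmn, by field_simp⟩
  -- `e3` gives `e2` slope 1 in `he2`, which in turn is the statement that `f` has slope 1 in `hf`.
  obtain ⟨e3, he3⟩ : ∃ e3, 3 * α + (2 * (-(wmn - an + 3 * e3 + 3 * rm + 6 * am) / 9) + 15 * am + 4 * an + 14 * e3) / 27 - 1 = 0 :=
    exists_zero_of_affine (40 / 81) (by norm_num) fun t => by ring
  obtain ⟨P, hP⟩ : ∃ P, P = -(wmn - an + 3 * e3 + 3 * rm + 6 * am) / 9 := ⟨_, rfl⟩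
  rw [← hP] at he3
  replace hP : 9 * P = -(wmn - an + 3 * e3 + 3 * rm + 6 * am) := by rw [hP]; ring
  obtain ⟨Q, hQ⟩ : ∃ Q, 3 * Q = -(2 * wmn + an + e3 + P) := ⟨-(2 * wmn + an + e3 + P) / 3, by ring⟩
  obtain ⟨E, hE⟩ : ∃ E, E = 2*P + wmn + Q + rm := ⟨_, rfl⟩
  obtain ⟨fm, fn, e1, -, -, he1, hcol⟩ := zCoupled_chain_coefficients (E := E) (wnm := wnm) (rn := rn) (zn := zn) b c (2 * ρ) hP hQ
  obtain ⟨e2, he2⟩ : ∃ t, 15 * α ^ 3 - 6 * α - 2 * b + e3 * (7 * α ^ 2 - 1) + 3 * α * t + e1 t - 1 = 0 := by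
    refine exists_zero_of_affine 1 one_ne_zero fun t => ?_
    rw [he1 t]
    linear_combination t * he3
  obtain ⟨hXm, hXn, hZn⟩ := hcol e2
  obtain ⟨e0, g0, g1, g2, core⟩ := zCoupled_chain_core (a := a) (c := c) (W := W) ham han hwmn hwnm hrm hrn h2 hzn hE rfl
    (by rw [hE]; linarith) (by linarith) hXm hXn hZn
  generalize e1 e2 = e1, fm e2 = fm, fn e2 = fn at *
  obtain ⟨g, hg⟩ : ∃ g : ℝ → ℝ, ∀ f, g f = -(ρ + c) + α * f - b := ⟨_, fun _ => rfl⟩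
  obtain ⟨h, hh⟩ : ∃ h : ℝ → ℝ, ∀ f, h f = -(f + α * (ρ + c - α * f)) - 2 * ρ * b := ⟨_, fun _ => rfl⟩
  obtain ⟨k, hk⟩ : ∃ k : ℝ → ℝ, ∀ f, k f = -(g f + α * (f + α * (ρ + c - α * f))) - b * (2 * f + ρ * E) := ⟨_, fun _ => rfl⟩
  obtain ⟨f, hf⟩ : ∃ f, e0*(-α) + e1*(f - α^2) + e2*(g f + 2*α*f - α^3) + e3*(h f + 3*α*g f + 3*α^2*f - α^4) +
      (k f + 4*α*h f + 6*α^2*g f + 4*α^3*f - α^5) + ρ*(g0 + g1*α + g2*α^2 + rm*α^3) = 0 := by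
    refine exists_zero_of_affine 1 one_ne_zero fun t => ?_
    simp only [hk, hh, hg]
    linear_combination t * he2
  refine ⟨![![ρ + c, -f, 0], ![P + rm + wmn + c, -fm, 0], ![Q + rn + wnm + c, -fn - zn, zn]], fun X D J hP hD => ?_⟩
  have d0 := hD 0 (by simp)
  have d1 := hD 1 (by simp)
  have d2 := hD 2 (by simp)
  have d3 := hD 3 (by simp)
  have d4 := hD 4 (by simp)
  have d5 := hD 5 (by simp)
  have hx00 : X 0 0 0 = ρ + c := hP 0 0
  have hx01 : X 0 1 0 = -f := hP 0 1
  have hx02 : X 0 2 0 = 0 := hP 0 2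
  have hx12 : X 1 2 0 = 0 := hP 1 2
  have core := core X D J (hP 1 0) (hP 1 1) hx12 (hP 2 0) (hP 2 1) (hP 2 2) hx02
  have J0 := J.x_succ
  have J1 := J.y_succ
  have J2 := J.z_succ
  have E0 := J.dx_succ
  have E1 := J.dy_succ
  have E2 := J.dz_succ
  simp only [Fin.sum_univ_three, reduceIte, Fin.reduceEq, add_zero] at J0 J1 J2 E0 E1 E2
  have hf0 : X 0 0 1 = f := by rw [J0, hx01, hx02]; ring
  have hs1 : X 0 2 1 = b := by
    rw [J2]; simp [hx02, hx12, h2]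
  have hzm1 : X 1 2 1 = 2 * b := by
    rw [J2, hwmn, hP 2 2, hx12, hx02]; simp [hx12]; linear_combination -hzn
  have hs2 : X 0 2 2 = b * (2 * ρ) := by
    rw [J2, h1, h2]; simp [sum_range_succ, hx00, hx02, hs1, hzm1]; ring
  obtain ⟨-, -, hm2, -, core⟩ := core hs2
  have hy1 : X 0 1 1 = ρ + c - α * f := by rw [J1, hx00, hx01, hα]; ring
  have hg0 : X 0 0 2 = g f := by rw [J0, hy1, hs1, hg]; ring
  have hy2 : X 0 1 2 = f + α * (ρ + c - α * f) := by rw [J1, hy1, hf0, hα]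
  have hh0 : X 0 0 3 = h f := by rw [J0, hy2, hs2, hh]; ring
  have hs3 : X 0 2 3 = b * (2 * f + ρ * E) := by
    rw [J2, h1, h2]; simp [sum_range_succ, hx00, hx02, hs1, hs2, hf0, hm2]; ring
  have hk0 : X 0 0 4 = k f := by rw [J0, J1, hg0, hy2, hs3, hα, hk]
  generalize g f = g, h f = h, k f = k at *
  have y1 : D 0 1 1 = α * D 0 1 0 := by rw [E1, d0, hα]; ring
  have y2 : D 0 1 2 = α ^ 2 * D 0 1 0 := by rw [E1, d1, y1, hα]; ring
  have y3 : D 0 1 3 = α ^ 3 * D 0 1 0 := by rw [E1, d2, y2, hα]; ring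
  have y4 : D 0 1 4 = α ^ 4 * D 0 1 0 := by rw [E1, d3, y3, hα]; ring
  have y5 : D 0 1 5 = α ^ 5 * D 0 1 0 := by rw [E1, d4, y4, hα]; ring
  have z0 : D 0 2 0 = -D 0 1 0 := by linarith [E0 0 0]
  have z1 : D 0 2 1 = -(α * D 0 1 0) := by linarith [E0 0 1]
  have z2 : D 0 2 2 = -(α ^ 2 * D 0 1 0) := by linarith [E0 0 2]
  have z3 : D 0 2 3 = -(α ^ 3 * D 0 1 0) := by linarith [E0 0 3]
  have z4 : D 0 2 4 = -(α ^ 4 * D 0 1 0) := by linarith [E0 0 4]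
  have u0 := E2 0 0
  have u1 := E2 0 1
  have u2 := E2 0 2
  have u3 := E2 0 3
  have u4 := E2 0 4
  rw [E0, y5]
  simp only [sum_range_succ, sum_range_zero, d0, d1, d2, d3, d4, z0, z1, z2, z3, z4, hx00, hx02, hf0, hg0, hh0, hk0,
    h1, h2, Nat.choose] at u0 u1 u2 u3 u4 core
  norm_num at u0 u1 u2 u3 u4 core ⊢
  rw [u4]
  linear_combination D 0 1 0 * hf - ρ * core - e0 * u0 - e1 * u1 - e2 * u2 - e3 * u3
end ThreeNodes

/-! ### From degenerate points to long measurements. -/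

section Undetected
variable {a : Fin 3 → ℝ} {b c ρ : ℝ} {W : Fin 3 → Fin 3 → ℝ}

/-- The measurement of a single variable is so long that it has to determine the other ones. -/
def IsLongMeasurement (q : Fin 3) (κ : Fin 3 → ℕ) : Prop :=
  q = 0 ∧ (7 ≤ κ 0 ∨ 8 ≤ κ 1) ∨ q = 1 ∧ (6 ≤ κ 1 ∨ 7 ≤ κ 0) ∨ q = 2 ∧ (6 ≤ κ 2 ∨ 7 ≤ κ 0 ∨ 8 ≤ κ 1)

/-- Here `y` is uncoupled, so its derivative at `s` reveals `x` one order later; under `z` coupling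
the same argument applies twice. -/
theorem xCoupled_y {K : ℕ} (h : ∃ P : Fin 3 → Fin 3 → ℝ, ∀ X D, IsJet 0 a b c W X D →
      (∀ i v, X i v 0 = P i v) → (∀ k < K, D 0 0 k = 0) → D 0 0 K = 0) :
    ∃ P : Fin 3 → Fin 3 → ℝ, ∀ X D, IsJet 0 a b c W X D →
      (∀ i v, X i v 0 = P i v) → (∀ k < K + 1, D 0 1 k = 0) → D 0 1 (K + 1) = 0 := by
  obtain ⟨P, h⟩ := h
  refine ⟨P, fun X D J hP hD => ?_⟩
  have E1 := J.dy_succ 0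
  simp only [Fin.reduceEq, reduceIte, add_zero] at E1
  have hx : D 0 0 K = 0 := h X D J hP fun k hk => by
    have := E1 k
    rw [hD k (by omega), hD (k + 1) (by omega)] at this
    linarith
  rw [E1, hx, hD K (by omega)]; ring

theorem zCoupled_y {K : ℕ} (h : ∃ P : Fin 3 → Fin 3 → ℝ, ∀ X D, IsJet 2 a b c W X D →
      (∀ i v, X i v 0 = P i v) → (∀ k < K, D 0 2 k = 0) → D 0 2 K = 0) :
    ∃ P : Fin 3 → Fin 3 → ℝ, ∀ X D, IsJet 2 a b c W X D →
      (∀ i v, X i v 0 = P i v) → (∀ k < K + 2, D 0 1 k = 0) → D 0 1 (K + 2) = 0 := by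
  obtain ⟨P, h⟩ := h
  refine ⟨P, fun X D J hP hD => ?_⟩
  have E0 := J.dx_succ 0
  have E1 := J.dy_succ 0
  simp only [Fin.reduceEq, reduceIte, add_zero] at E0 E1
  have hx : ∀ k < K + 1, D 0 0 k = 0 := fun k hk => by
    have := E1 k
    rw [hD k (by omega), hD (k + 1) (by omega)] at this
    linarith
  have hz : D 0 2 K = 0 := h X D J hP fun k hk => by
    have := E0 k
    rw [hD k (by omega), hx (k + 1) (by omega)] at this
    linarith
  rw [E1, E0, hz, hD K (by omega), hD (K + 1) (by omega)]; ring

theorem zCoupled_chain_z (hρ : ρ ≠ 0) (h1 : W 0 1 = ρ) (h2 : W 0 2 = 0) (h12 : W 1 2 ≠ 0) :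
   ∃ P : Fin 3 → Fin 3 → ℝ, ∀ X D, IsJet 2 a b c W X D →
   (∀ i v, X i v 0 = P i v) → (∀ k < 5, D 0 2 k = 0) → D 0 2 5 = 0 := by
  by_cases hb : b = 0
  · exact zCoupled_chain_z_of_eq_zero hρ h1 h2 h12 hb
  · exact zCoupled_chain_z_of_ne_zero h1 h2 h12 hb

/-- At a suitable point, a long measurement has a component whose differential depends on the others. -/
theorem exists_dependent_component {q : Fin 3} {κ : Fin 3 → ℕ} (hκ : IsLongMeasurement q κ) (hρ : ρ ≠ 0)
    (h1 : W 0 1 = ρ) (h2 : W 0 2 = ρ ∨ W 0 2 = 0 ∧ W 1 2 ≠ 0) :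
    ∃ (P : Fin 3 → Fin 3 → ℝ) (v₀ : Fin 3) (k₀ : ℕ), k₀ < κ v₀ ∧ ∀ X D, IsJet q a b c W X D →
      (∀ i v, X i v 0 = P i v) → (∀ k < k₀, D 0 v₀ k = 0) → D 0 v₀ k₀ = 0 := by
  suffices ∃ (v₀ : Fin 3) (k₀ : ℕ), k₀ < κ v₀ ∧ ∃ P : Fin 3 → Fin 3 → ℝ, ∀ X D, IsJet q a b c W X D →
      (∀ i v, X i v 0 = P i v) → (∀ k < k₀, D 0 v₀ k = 0) → D 0 v₀ k₀ = 0 by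
    obtain ⟨v₀, k₀, hk, P, hP⟩ := this
    exact ⟨P, v₀, k₀, hk, hP⟩
  rcases hκ with ⟨rfl, h | h⟩ | ⟨rfl, h | h⟩ | ⟨rfl, h | h | h⟩ <;> rcases h2 with h2 | ⟨h2, h12⟩
  · exact ⟨0, 4, by omega, xCoupled_star_x h1 h2⟩
  · exact ⟨0, 4, by omega, xCoupled_chain_x h1 h2⟩
  · exact ⟨1, 5, by omega, xCoupled_y (xCoupled_star_x h1 h2)⟩
  · exact ⟨1, 5, by omega, xCoupled_y (xCoupled_chain_x h1 h2)⟩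
  · exact ⟨1, 4, by omega, yCoupled_star_y h1 h2⟩
  · exact ⟨1, 5, by omega, yCoupled_chain_y h1 h2⟩
  · exact ⟨0, 5, by omega, yCoupled_star_x h1 h2⟩
  · exact ⟨0, 6, by omega, yCoupled_chain_x hρ h1 h2 h12⟩
  · exact ⟨2, 4, by omega, zCoupled_star_z hρ h1 h2⟩
  · exact ⟨2, 5, by omega, zCoupled_chain_z hρ h1 h2 h12⟩
  · exact ⟨0, 3, by omega, zCoupled_star_x h1 h2⟩
  · exact ⟨0, 6, by omega, zCoupled_chain_x h1 h2 h12⟩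
  · exact ⟨1, 6, by omega, zCoupled_y (zCoupled_star_z hρ h1 h2)⟩
  · exact ⟨1, 7, by omega, zCoupled_y (zCoupled_chain_z hρ h1 h2 h12)⟩
end Undetected

/-- If a long measurement does not see a perturbation outside the node, it does not see it through the coupled variable. -/
theorem IsJet.coupled_variation_eq_zero {ι : Type*} [Fintype ι] {q : Fin 3} {a : ι → ℝ} {b c : ℝ} {W : ι → ι → ℝ}
    {X D : ι → Fin 3 → ℕ → ℝ} (J : IsJet q a b c W X D) {κ : Fin 3 → ℕ} (hκ : IsLongMeasurement q κ) {s : ι}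
    (h0 : ∀ v, D s v 0 = 0) (h : ∀ v, ∀ k < κ v, D s v k = 0) : ∀ k < 4, D s q k = 0 := by
  have E0 := J.dx_succ s
  have E1 := J.dy_succ s
  have E2 := J.dz_succ s
  rcases hκ with ⟨rfl, hκ | hκ⟩ | ⟨rfl, hκ | hκ⟩ | ⟨rfl, hκ | hκ | hκ⟩ <;> intro k hk <;>
    simp only [Fin.reduceEq, reduceIte, add_zero] at E0 E1 E2
  · exact h 0 k (by omega)
  · have := E1 k
    rw [h 1 k (by omega), h 1 (k + 1) (by omega)] at this
    linarith
  · exact h 1 k (by omega)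
  -- With no `x` variation, the uncoupled `z` equation is linear homogeneous in the `z` variation,
  -- which starts at zero.
  · have hz : ∀ k < 5, D s 2 k = 0 := by
      intro k
      induction k using Nat.strong_induction_on with
      | _ k ih =>
        intro hk
        rcases k with - | k
        · exact h0 2
        · rw [E2, ih k (by omega) (by omega), sum_eq_zero, mul_zero, sub_zero]
          intro l hl
          have : l < k + 1 := by simpa using hl
          rw [h 0 (k - l) (by omega), ih l (by omega) (by omega)]; ring
    have := E0 k
    rw [hz k (by omega), h 0 (k + 1) (by omega)] at this
    linarith
  · exact h 2 k (by omega)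
  · have hy : ∀ k < 5, D s 1 k = 0 := by
      intro k
      induction k with
      | zero => exact fun _ => h0 1
      | succ k ih => intro hk; rw [E1, ih (by omega), h 0 k (by omega)]; ring
    have := E0 k
    rw [hy k (by omega), h 0 (k + 1) (by omega)] at this
    linarith
  · have hx : ∀ k < 5, D s 0 k = 0 := fun k hk => by
      have := E1 k
      rw [h 1 k (by omega), h 1 (k + 1) (by omega)] at this
      linarith
    have := E0 k
    rw [hx (k + 1) (by omega), h 1 k (by omega)] at this
    linarith

/-! ### Constraints on the measurement and on the graph. -/

section Main
variable {N : ℕ} {a : Fin N → ℝ} {b c ρ : ℝ} {A : Matrix (Fin N) (Fin N) ℝ} {q : Fin 3}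
  {s : Fin N} {κ : Fin 3 → ℕ} {S : Finset (Fin N)}

theorem ReconstructsGlobally.not_dependent (h : ReconstructsGlobally (rosslerNetwork a b c ρ A q) s κ S)
    (x : NetState N) {v₀ : Fin 3} {k₀ : ℕ} (hk₀ : k₀ < κ v₀)
    (hdep : ∀ δ, (∀ v k, k < κ v → (v ≠ v₀ ∨ k ≠ k₀) → jetVariation a b c ρ A q x δ s v k = 0) →
      jetVariation a b c ρ A q x δ s v₀ k₀ = 0) : False := by
  obtain ⟨δ, h1, h0⟩ := h.exists_jetVariation_eq_single x hk₀
  rw [hdep δ h0] at h1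
  exact zero_ne_one h1

/-- At the origin, uncoupled equations give dependences: from `y' = x + a y`, from `x' = -y - z`,
and from the `z` equation, where `z = 0` removes the `x` variation. Each forbids a pattern of `κ`;
the total 9 does the rest. -/
theorem ReconstructsGlobally.isLongMeasurement (h : ReconstructsGlobally (rosslerNetwork a b c ρ A q) s κ S)
    (hS : S.card = 3) : IsLongMeasurement q κ := by
  have hsum : κ 0 + κ 1 + κ 2 = 9 := by
    have := h.1
    rwa [hS, Fin.sum_univ_three] at this
  have J := fun δ => isJet_jet a b c ρ A q 0 δ
  have E0 := fun δ => (J δ).dx_succ s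
  have E1 := fun δ => (J δ).dy_succ s
  have hz : ∀ δ, q ≠ 2 → jetVariation a b c ρ A q 0 δ s 2 0 = 0 → jetVariation a b c ρ A q 0 δ s 2 1 = 0 := by
    intro δ hq h0
    rw [(J δ).dz_succ s 0, if_neg hq]
    simp [h0, jet_zero]
  fin_cases q <;> simp only [Fin.zero_eta, Fin.mk_one, Fin.reduceFinMk, Fin.reduceEq, reduceIte, add_zero] at *
  · have h2 : ¬ 2 ≤ κ 2 := fun h2 => h.not_dependent 0 (v₀ := 2) (k₀ := 1) (by omega) fun δ hδ =>
      hz δ (by simp) (hδ 2 0 (by omega) (by simp))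
    have h3 : ¬ (1 ≤ κ 0 ∧ 2 ≤ κ 1) := fun ⟨_, _⟩ => h.not_dependent 0 (v₀ := 1) (k₀ := 1) (by omega) fun δ hδ => by
      rw [E1, hδ 0 0 (by omega) (by simp), hδ 1 0 (by omega) (by simp)]; ring
    exact .inl ⟨rfl, by omega⟩
  · have h2 : ¬ 2 ≤ κ 2 := fun h2 => h.not_dependent 0 (v₀ := 2) (k₀ := 1) (by omega) fun δ hδ =>
      hz δ (by simp) (hδ 2 0 (by omega) (by simp))
    have h3 : ¬ (3 ≤ κ 0 ∧ 2 ≤ κ 1) := fun ⟨_, _⟩ => h.not_dependent 0 (v₀ := 0) (k₀ := 2) (by omega) fun δ hδ => by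
      have z0 := E0 δ 0
      rw [hδ 0 1 (by omega) (by simp), hδ 1 0 (by omega) (by simp)] at z0
      rw [E0, hz δ (by simp) (by linarith), hδ 1 1 (by omega) (by simp)]; ring
    exact .inr (.inl ⟨rfl, by omega⟩)
  · have h1 : ¬ (1 ≤ κ 0 ∧ 2 ≤ κ 1) := fun ⟨_, _⟩ => h.not_dependent 0 (v₀ := 1) (k₀ := 1) (by omega) fun δ hδ => by
      rw [E1, hδ 0 0 (by omega) (by simp), hδ 1 0 (by omega) (by simp)]; ring
    have h2 : ¬ (3 ≤ κ 1 ∧ 1 ≤ κ 2) := fun ⟨_, _⟩ => h.not_dependent 0 (v₀ := 1) (k₀ := 2) (by omega) fun δ hδ => by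
      rw [E1, E0, hδ 1 0 (by omega) (by simp), hδ 2 0 (by omega) (by simp), hδ 1 1 (by omega) (by simp)]; ring
    have h3 : ¬ (3 ≤ κ 0 ∧ 2 ≤ κ 2) := fun ⟨_, _⟩ => h.not_dependent 0 (v₀ := 0) (k₀ := 2) (by omega) fun δ hδ => by
      have y0 := E0 δ 0
      rw [hδ 0 1 (by omega) (by simp), hδ 2 0 (by omega) (by simp)] at y0
      rw [E0, E1, hδ 2 1 (by omega) (by simp), hδ 0 0 (by omega) (by simp),
        show jetVariation a b c ρ A 2 0 δ s 1 0 = 0 by linarith]; ring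
    have h4 : ¬ (1 ≤ κ 1 ∧ 2 ≤ κ 0 ∧ 1 ≤ κ 2) := fun ⟨_, _, _⟩ => h.not_dependent 0 (v₀ := 0) (k₀ := 1) (by omega) fun δ hδ => by
      rw [E0, hδ 1 0 (by omega) (by simp), hδ 2 0 (by omega) (by simp)]; ring
    exact .inr (.inr ⟨rfl, by omega⟩)

theorem ReconstructsGlobally.mem (h : ReconstructsGlobally (rosslerNetwork a b c ρ A q) s κ S)
    {v : Fin 3} (hv : 0 < κ v) : s ∈ S := by
  by_contra hs
  have := h.jetVariation_eq_zero (x := 0) (δ := Pi.single s 1)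
    (fun j hj v => by rw [Pi.single_eq_of_ne (by rintro rfl; exact hs hj)]; rfl) hv
  rw [jetVariation_zero, Pi.single_eq_same] at this
  exact one_ne_zero this

/-- All the nodes of `S` act on `s`. -/
theorem ReconstructsGlobally.subset_of_closed (h : ReconstructsGlobally (rosslerNetwork a b c ρ A q) s κ S)
    {T : Set (Fin N)} (hs : s ∈ T) (hT : ∀ i ∈ T, ∀ j ∉ T, ρ * A i j = 0) : ↑S ⊆ T := by
  intro n hn
  by_contra hnT
  have := h.eq_zero (x := 0) (δ := Pi.single n 1) (fun v k _ =>
    (isJet_jet a b c ρ A q 0 (Pi.single n 1)).variation_eq_zero_of_closed hT (fun i hi v => by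
      rw [jetVariation_zero, Pi.single_eq_of_ne (by rintro rfl; exact hnT hi)]; rfl) k s hs v) hn 0
  rw [Pi.single_eq_same] at this
  exact one_ne_zero this

/-- No node outside `S` acts on `s` through a short walk. -/
theorem ReconstructsGlobally.pow_apply_eq_zero (h : ReconstructsGlobally (rosslerNetwork a b c ρ A q) s κ S)
    (hA : ∀ i j, 0 ≤ A i j) (hρ : ρ ≠ 0) (hκ : IsLongMeasurement q κ) (hs : s ∈ S) {j : Fin N} (hj : j ∉ S) :
    ∀ d < 4, (A ^ d) s j = 0 := by
  have J := isJet_jet a b c ρ A q 0 (Pi.single j (Pi.single q 1))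
  have hrow := J.coupled_variation_eq_zero hκ (s := s)
    (fun v => by rw [jetVariation_zero, Pi.single_eq_of_ne (by rintro rfl; exact hj hs)]; rfl)
    fun v k hk => h.jetVariation_eq_zero
      (fun i hi v => by rw [Pi.single_eq_of_ne (by rintro rfl; exact hj hi)]; rfl) hk
  intro d
  induction d using Nat.strong_induction_on with
  | _ d ih =>
    intro hd
    have := (J.variation_eq_pow hA (j := j) (fun i v => by
      rw [jetVariation_zero]
      by_cases hi : i = j
      · subst hi; simp [Pi.single_apply]
      · simp [hi]) d s fun k hk => ih k hk (by omega)).2 q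
    rw [hrow d hd, if_pos rfl] at this
    simpa [hρ] using this.symm

theorem not_reconstructsGlobally_of_three (h : ReconstructsGlobally (rosslerNetwork a b c ρ A q) s κ S)
    (hκ : IsLongMeasurement q κ) (hρ : ρ ≠ 0) {m n : Fin N} (hsm : s ≠ m) (hsn : s ≠ n) (hmn : m ≠ n)
    (h1 : A s m = 1) (h2 : A s n = 1 ∨ A s n = 0 ∧ A m n ≠ 0)
    (hs : ∀ j, j ≠ s → j ≠ m → j ≠ n → A s j = 0) (hm : ∀ j, j ≠ s → j ≠ m → j ≠ n → A m j = 0)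
    (hn : ∀ j, j ≠ s → j ≠ m → j ≠ n → A n j = 0) : False := by
  obtain ⟨P, v₀, k₀, hk₀, hP⟩ := exists_dependent_component (a := ![a s, a m, a n]) (b := b) (c := c)
    (W := fun i j => ρ * A (![s, m, n] i) (![s, m, n] j)) hκ hρ (by simp [h1]) (by simpa [hρ] using h2)
  have hσ : Function.Injective ![s, m, n] := by
    intro i j
    fin_cases i <;> fin_cases j <;> simp [hsm, hsn, hmn, hsm.symm, hsn.symm, hmn.symm]
  -- The remaining nodes sit at the origin; they do not act on the three, so any values would do.
  refine h.not_dependent (Function.extend ![s, m, n] P 0) hk₀ fun δ hδ => ?_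
  have J := (isJet_jet a b c ρ A q (Function.extend ![s, m, n] P 0) δ).comp hσ fun i j hj => by
    have hj' : j ≠ s ∧ j ≠ m ∧ j ≠ n := by
      refine ⟨?_, ?_, ?_⟩ <;> rintro rfl <;> apply hj
      exacts [⟨0, rfl⟩, ⟨1, rfl⟩, ⟨2, rfl⟩]
    fin_cases i <;> simp [hs j hj'.1 hj'.2.1 hj'.2.2, hm j hj'.1 hj'.2.1 hj'.2.2, hn j hj'.1 hj'.2.1 hj'.2.2]
  have ha : (fun i => a (![s, m, n] i)) = ![a s, a m, a n] := by
    funext i; fin_cases i <;> rfl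
  rw [ha] at J
  refine hP _ _ J (fun i v => ?_) fun k hk => hδ v₀ k (by omega) (.inr hk.ne)
  rw [jet_zero, hσ.extend_apply]

end Main

theorem proposition3 {N : ℕ} (a : Fin N → ℝ) (b c ρ : ℝ)
    (A : Matrix (Fin N) (Fin N) ℝ) (hA : ∀ i j, A i j = 0 ∨ A i j = 1)
    (q : Fin 3) (s : Fin N) (S : Finset (Fin N)) (hS : S.card = 3) :
    ¬ ∃ κ : Fin 3 → ℕ, ReconstructsGlobally (rosslerNetwork a b c ρ A q) s κ S := by
  rintro ⟨κ, h⟩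
  have hA0 : ∀ i j, 0 ≤ A i j := fun i j => by rcases hA i j with h | h <;> simp [h]
  have hκ := h.isLongMeasurement hS
  have hs : s ∈ S := by
    rcases hκ with ⟨-, hκ | hκ⟩ | ⟨-, hκ | hκ⟩ | ⟨-, hκ | hκ | hκ⟩ <;> exact h.mem (Nat.lt_of_lt_of_le (by norm_num) hκ)
  -- Otherwise `{s}` would be closed and contain `S`.
  obtain ⟨l, hsl, hl⟩ : ∃ l, l ≠ s ∧ ρ * A s l ≠ 0 := by
    by_contra! hc
    have := h.subset_of_closed (T := {s}) rfl fun i hi j hj => by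
      obtain rfl : i = s := hi
      exact hc j hj
    have := card_le_card (show S ⊆ {s} from fun j hj => by simpa using this hj)
    simp [hS] at this
  have hρ : ρ ≠ 0 := left_ne_zero_of_mul hl
  -- Walks of length 1, 2, 3 show that no edge from outside `S` enters `s`, its neighbours, or their
  -- neighbours.
  have hpow := fun j (hj : j ∉ S) => h.pow_apply_eq_zero hA0 hρ hκ hs hj
  have hsj : ∀ j ∉ S, A s j = 0 := fun j hj => by simpa using hpow j hj 1 (by norm_num)
  have hlj : ∀ l, A s l ≠ 0 → ∀ j ∉ S, A l j = 0 := fun l hl j hj => by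
    simpa using pow_apply_eq_zero_of_pow_succ hA0 (hpow j hj 2 (by norm_num)) hl
  have hkj : ∀ l, A s l ≠ 0 → ∀ k, A l k ≠ 0 → ∀ j ∉ S, A k j = 0 := fun l hl k hk j hj => by
    simpa using pow_apply_eq_zero_of_pow_succ hA0
      (pow_apply_eq_zero_of_pow_succ hA0 (hpow j hj 3 (by norm_num)) hl) hk
  replace hl : A s l ≠ 0 := right_ne_zero_of_mul hl
  have hlS : l ∈ S := by
    by_contra hc
    exact hl (hsj l hc)
  obtain ⟨n, hn⟩ : ∃ n, (S.erase s).erase l = {n} := by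
    rw [← card_eq_one, card_erase_of_mem (by simp [hsl, hlS]), card_erase_of_mem hs, hS]
  have hSn : ∀ j, j ∈ S ↔ j = s ∨ j = l ∨ j = n := by
    intro j
    have := congrArg (j ∈ ·) hn
    simp only [mem_erase, mem_singleton, eq_iff_iff] at this
    by_cases h1 : j = s
    · simp [h1, hs]
    · by_cases h2 : j = l
      · simp [h2, hlS]
      · simpa [h1, h2] using this
  have hn' : n ≠ l ∧ n ≠ s := by
    have := hn ▸ mem_singleton_self n
    simp only [mem_erase] at this
    exact ⟨this.1, this.2.1⟩
  have hout : ∀ j, j ≠ s → j ≠ l → j ≠ n → j ∉ S := fun j h1 h2 h3 hj => by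
    rcases (hSn j).1 hj with h | h | h <;> contradiction
  have h1 : A s l = 1 := (hA s l).resolve_left hl
  by_cases hsn : A s n = 0
  · have hln : A l n ≠ 0 := by
      intro hln
      have := h.subset_of_closed (T := {s, l}) (by simp) (fun i hi j hj => by
        simp only [Set.mem_insert_iff, Set.mem_singleton_iff, not_or] at hi hj
        by_cases hjn : j = n
        · subst hjn
          rcases hi with rfl | rfl
          · rw [hsn, mul_zero]
          · rw [hln, mul_zero]
        · rcases hi with rfl | rfl
          · rw [hsj j (hout j hj.1 hj.2 hjn), mul_zero]
          · rw [hlj _ hl j (hout j hj.1 hj.2 hjn), mul_zero]) ((hSn n).2 (by simp))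
      simp [hn'.1, hn'.2] at this
    exact not_reconstructsGlobally_of_three h hκ hρ hsl.symm hn'.2.symm hn'.1.symm h1 (.inr ⟨hsn, hln⟩)
      (fun j a b c => hsj j (hout j a b c)) (fun j a b c => hlj l hl j (hout j a b c))
      fun j a b c => hkj l hl n hln j (hout j a b c)
  · exact not_reconstructsGlobally_of_three h hκ hρ hsl.symm hn'.2.symm hn'.1.symm h1
      (.inl ((hA s n).resolve_left hsn))
      (fun j a b c => hsj j (hout j a b c)) (fun j a b c => hlj l hl j (hout j a b c))
      fun j a b c => hlj n hsn j (hout j a b c)
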